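/- Let $I_k=(r_k,s_k)$, $k=1,2,\dots$, be pairwise disjoint nonempty open subintervals of $(0,1)$, let $\ell_k=s_k-r_k$, put $r_0=1$, $s_0=0$, and let $$\Omega=(-\infty,0)\cup(1,\infty)\cup\bigcup_{k=1}^{\infty}I_k .$$ Let $P=\frac{1}{2\pi i}\frac{d}{dx}$ be the maximal momentum operator in $L^2(\Omega)$: its domain consists of the $f\in L^2(\Omega)$ that are absolutely continuous on every compact interval contained in $\Omega$ and satisfy $f'\in L^2(\Omega)$. For a unitary $B$ on $\ell^2=\ell^2(\{0,1,2,\dots\})$ let $P_B$ be the closure of the restriction of $P$ to the functions $f$ whose one-sided boundary values $(f(r_k^+))_{k\ge 0}$ and $(f(s_k^-))_{k\ge 0}$ exist, belong to $\ell^2$ and satisfy $$B\,\bigl(f(r_k^+)\bigr)_{k\ge 0}=\bigl(f(s_k^-)\bigr)_{k\ge 0}.$$ Thus the index $0$ couples the two half-lines through the values $f(1^+)$ and $f(0^-)$. **Theorem.** If $B=\mathrm{diag}(1,1,\dots)$ is the identity of $\ell^2$, then $P_B$ is a selfadjoint restriction of $P$, its spectrum is the real line, and its set of eigenvalues is $$\Lambda_p=\bigcup_{k=1}^{\infty}\frac1{\ell_k}\mathbb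 Z .$$ This point spectrum is embedded in the continuous spectrum: the part of $P_B$ in the orthogonal complement of all its eigenvectors has spectrum $\mathbb R$, so that every $\lambda\in\Lambda_p$ lies in it. The multiplicity of $\lambda\in\Lambda_p$, i.e. the dimension of the eigenspace as an element of $\{1,2,\dots,\infty\}$, equals the number of elements of $\{k\ge 1:\lambda\ell_k\in\mathbb Z\}$ (which may be infinite, as for $\lambda=0$). -/

import Mathlib

open MeasureTheory Set Filter Topology

noncomputable section

/-! ### Spectral notions for unbounded operators on a Hilbert space -/

namespace UnboundedOperator

variable {H : Type*} [NormedAddCommGroup H] [InnerProductSpace ℂ H]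

/-- `z` is in the resolvent set of `T` if `T - z : dom T → H` is a bijection with a bounded
everywhere defined inverse `R`. -/
def resolventSet (T : H →ₗ.[ℂ] H) : Set ℂ :=
  {z | ∃ R : H →L[ℂ] H,
    (∀ y : H, ∃ x : T.domain, (x : H) = R y ∧ T x - z • (x : H) = y) ∧
    (∀ x : T.domain, R (T x - z • (x : H)) = x)}

/-- The spectrum of `T`, the complement of the resolvent set. -/
def spectrum (T : H →ₗ.[ℂ] H) : Set ℂ := (resolventSet T)ᶜ

/-- The eigenspace `{x ∈ dom T | T x = z x}`. -/
def eigenspace (T : H →ₗ.[ℂ] H) (z : ℂ) : Submodule ℂ H :=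
  T.graph.comap (LinearMap.prod LinearMap.id (z • LinearMap.id))

theorem mem_eigenspace {T : H →ₗ.[ℂ] H} {z : ℂ} {x : H} :
    x ∈ eigenspace T z ↔ ∃ y : T.domain, (y : H) = x ∧ T y = z • x := by
  simp [eigenspace, LinearPMap.mem_graph_iff]

/-- The point spectrum: the set of eigenvalues of `T`. -/
def pointSpectrum (T : H →ₗ.[ℂ] H) : Set ℂ := {z | eigenspace T z ≠ ⊥}

/-- The multiplicity of `z`: the dimension of the eigenspace, a natural number or `∞`.
(In a separable Hilbert space an infinite Hilbert space dimension is always countable.) -/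
def multiplicity (T : H →ₗ.[ℂ] H) (z : ℂ) : ℕ∞ :=
  Cardinal.toENat (Module.rank ℂ (eigenspace T z))

/-- The part of `T` in a subspace `K`: its domain is `{x ∈ K ∩ dom T | T x ∈ K}`. -/
def part (T : H →ₗ.[ℂ] H) (K : Submodule ℂ H) : K →ₗ.[ℂ] K :=
  (T.graph.comap (K.subtype.prodMap K.subtype)).toLinearPMap

theorem mem_graph_part {T : H →ₗ.[ℂ] H} {K : Submodule ℂ H} {x y : K} :
    (x, y) ∈ (part T K).graph ↔ ((x : H), (y : H)) ∈ T.graph := by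
  rw [part, Submodule.toLinearPMap_graph_eq]
  · simp
  · rintro ⟨x, y⟩ h hx
    simp only [Submodule.mem_comap, LinearMap.prodMap_apply, Submodule.subtype_apply] at h hx ⊢
    subst hx
    exact Subtype.ext (T.graph_fst_eq_zero_snd h (by simp))

/-- The continuous subspace: the orthogonal complement of all eigenvectors. -/
def continuousSubspace (T : H →ₗ.[ℂ] H) : Submodule ℂ H :=
  (⨆ z : ℂ, eigenspace T z)ᗮ

/-- The continuous spectrum: the spectrum of the part of `T` in its continuous subspace. -/
def continuousSpectrum (T : H →ₗ.[ℂ] H) : Set ℂ :=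
  spectrum (part T (continuousSubspace T))

/-- The embedded point spectrum: the eigenvalues that lie in the continuous spectrum. -/
def embeddedPointSpectrum (T : H →ₗ.[ℂ] H) : Set ℂ :=
  pointSpectrum T ∩ continuousSpectrum T

end UnboundedOperator

/-! ### Momentum operators on two half-lines and infinitely many bounded intervals -/

/-- Endpoints `r k`, `s k` of pairwise disjoint nonempty open intervals
`I k = (r k, s k) ⊆ (0, 1)`, `k = 1, 2, …`. The index `0` belongs to the two half-lines:
`r 0 = 1` is the left endpoint of `(1, ∞)` and `s 0 = 0` the right endpoint of `(-∞, 0)`. -/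
structure IntervalSystem where
  r : ℕ → ℝ
  s : ℕ → ℝ
  r_zero : r 0 = 1
  s_zero : s 0 = 0
  r_lt_s : ∀ k, 1 ≤ k → r k < s k
  subset_unit : ∀ k, 1 ≤ k → Ioo (r k) (s k) ⊆ Ioo 0 1
  disjoint : ∀ k l, 1 ≤ k → 1 ≤ l → k ≠ l → Disjoint (Ioo (r k) (s k)) (Ioo (r l) (s l))

namespace IntervalSystem

/-- The Hilbert space `ℓ²` of boundary values, indexed by `k = 0, 1, 2, …`. -/
abbrev BoundarySpace : Type := lp (fun _ : ℕ => ℂ) 2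

variable (I : IntervalSystem)

/-- The open set `Ω = (-∞, 0) ∪ (1, ∞) ∪ ⋃_{k ≥ 1} (r k, s k)`. -/
def Ω : Set ℝ := Iio 0 ∪ Ioi 1 ∪ ⋃ (k : ℕ) (_ : 1 ≤ k), Ioo (I.r k) (I.s k)

/-- The length of the interval `I k`, for `k ≥ 1`. -/
def len (k : ℕ) : ℝ := I.s k - I.r k

/-- The Hilbert space `L²(Ω)`. -/
abbrev L2 : Type := Lp ℂ 2 (volume.restrict I.Ω)

/-- `F` is a representative of `f` that is absolutely continuous on every compact interval
contained in `Ω`, and `(1 / 2πi) F' = g` almost everywhere on `Ω`. -/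
structure IsRep (f g : I.L2) (F : ℝ → ℂ) : Prop where
  ae_eq : f =ᵐ[volume.restrict I.Ω] F
  absCont : ∀ a b : ℝ, a ≤ b → Icc a b ⊆ I.Ω → AbsolutelyContinuousOnInterval F a b
  hasDeriv : ∀ᵐ x ∂(volume.restrict I.Ω), HasDerivAt F (2 * Real.pi * Complex.I * g x) x

variable {I}

theorem IsRep.zero : I.IsRep 0 0 0 where
  ae_eq := Lp.coeFn_zero _ _ _
  absCont a b _ _ := by
    have h : LipschitzOnWith 0 (0 : ℝ → ℂ) (uIcc a b) := (LipschitzWith.const 0).lipschitzOnWith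
    exact h.absolutelyContinuousOnInterval
  hasDeriv := by
    filter_upwards [Lp.coeFn_zero ℂ 2 (volume.restrict I.Ω)] with x hx
    rw [hx]
    simp

theorem IsRep.add {f g f' g' : I.L2} {F F' : ℝ → ℂ} (h : I.IsRep f g F) (h' : I.IsRep f' g' F') :
    I.IsRep (f + f') (g + g') (F + F') where
  ae_eq := (Lp.coeFn_add _ _).trans (h.ae_eq.add h'.ae_eq)
  absCont a b hab hs := (h.absCont a b hab hs).add (h'.absCont a b hab hs)
  hasDeriv := by
    filter_upwards [Lp.coeFn_add g g', h.hasDeriv, h'.hasDeriv] with x hx h1 h2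
    rw [hx, Pi.add_apply, mul_add]
    exact h1.add h2

theorem IsRep.smul {f g : I.L2} {F : ℝ → ℂ} (c : ℂ) (h : I.IsRep f g F) :
    I.IsRep (c • f) (c • g) (c • F) where
  ae_eq := (Lp.coeFn_smul _ _).trans (h.ae_eq.const_smul c)
  absCont a b hab hs := (h.absCont a b hab hs).const_smul c
  hasDeriv := by
    filter_upwards [Lp.coeFn_smul c g, h.hasDeriv] with x hx h1
    rw [hx, Pi.smul_apply, smul_eq_mul, mul_left_comm]
    exact h1.const_smul c

theorem isOpen_Ω : IsOpen I.Ω :=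
  (isOpen_Iio.union isOpen_Ioi).union (isOpen_iUnion fun _ => isOpen_iUnion fun _ => isOpen_Ioo)

theorem IsRep.continuousOn {f g : I.L2} {F : ℝ → ℂ} (h : I.IsRep f g F) :
    ContinuousOn F I.Ω := by
  intro x hx
  obtain ⟨ε, hε, hb⟩ := Metric.isOpen_iff.1 (isOpen_Ω (I := I)) x hx
  have hsub : Icc (x - ε / 2) (x + ε / 2) ⊆ I.Ω := by
    intro y hy
    apply hb
    rw [Metric.mem_ball, Real.dist_eq, abs_lt]
    constructor <;> linarith [hy.1, hy.2]
  have hle : x - ε / 2 ≤ x + ε / 2 := by linarith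
  have hc := (h.absCont _ _ hle hsub).continuousOn
  rw [uIcc_of_le hle] at hc
  exact (hc.continuousAt (Icc_mem_nhds (by linarith) (by linarith))).continuousWithinAt

theorem IsRep.snd_eq_zero {g : I.L2} {F : ℝ → ℂ} (h : I.IsRep 0 g F) : g = 0 := by
  have h0 : F =ᵐ[volume.restrict I.Ω] (fun _ => (0 : ℂ)) :=
    h.ae_eq.symm.trans (Lp.coeFn_zero _ _ _)
  have hF : EqOn F (fun _ => (0 : ℂ)) I.Ω :=
    Measure.eqOn_open_of_ae_eq h0 isOpen_Ω h.continuousOn continuousOn_const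
  rw [Lp.eq_zero_iff_ae_eq_zero]
  filter_upwards [h.hasDeriv, ae_restrict_mem isOpen_Ω.measurableSet] with x hx hxΩ
  have hz : HasDerivAt F 0 x :=
    (hasDerivAt_const x (0 : ℂ)).congr_of_eventuallyEq
      (hF.eventuallyEq_of_mem (isOpen_Ω.mem_nhds hxΩ))
  have := hx.unique hz
  simpa [Real.pi_ne_zero, Complex.I_ne_zero] using this

variable (I)

/-- The graph of the maximal momentum operator. -/
def maxGraph : Submodule ℂ (I.L2 × I.L2) where
  carrier := {p | ∃ F : ℝ → ℂ, I.IsRep p.1 p.2 F}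
  zero_mem' := ⟨0, .zero⟩
  add_mem' := by
    rintro p q ⟨F, hF⟩ ⟨G, hG⟩
    exact ⟨_, hF.add hG⟩
  smul_mem' := by
    rintro c p ⟨F, hF⟩
    exact ⟨_, hF.smul c⟩

/-- The maximal momentum operator `P f = (1 / 2πi) f'` in `L²(Ω)`, whose domain consists of the
(locally) absolutely continuous `f` on `Ω` with `f` and `P f` square-integrable. -/
def maximalMomentum : I.L2 →ₗ.[ℂ] I.L2 := I.maxGraph.toLinearPMap

theorem mem_graph_maximalMomentum {f g : I.L2} :
    (f, g) ∈ I.maximalMomentum.graph ↔ ∃ F : ℝ → ℂ, I.IsRep f g F := by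
  rw [maximalMomentum, Submodule.toLinearPMap_graph_eq]
  · rfl
  · rintro ⟨f, g⟩ ⟨F, hF⟩ (rfl : f = 0)
    exact hF.snd_eq_zero

/-- `F` has the one-sided boundary values `u k = F(r k +)` and `v k = F(s k -)` in `ℓ²`. -/
def HasBoundaryValues (F : ℝ → ℂ) (u v : BoundarySpace) : Prop :=
  ∀ k, Tendsto F (𝓝[>] I.r k) (𝓝 (u k)) ∧ Tendsto F (𝓝[<] I.s k) (𝓝 (v k))

/-- The graph of the maximal momentum operator restricted to those `f` whose boundary values
are in `ℓ²` and satisfy `B (f(r 0 +), f(r 1 +), …) = (f(s 0 -), f(s 1 -), …)`. -/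
def boundaryGraph (B : unitary (BoundarySpace →L[ℂ] BoundarySpace)) :
    Submodule ℂ (I.L2 × I.L2) where
  carrier := {p | ∃ (F : ℝ → ℂ) (u : BoundarySpace), I.IsRep p.1 p.2 F ∧
    I.HasBoundaryValues F u ((B : BoundarySpace →L[ℂ] BoundarySpace) u)}
  zero_mem' := by
    refine ⟨0, 0, .zero, fun k => ?_⟩
    rw [map_zero]
    exact ⟨tendsto_const_nhds, tendsto_const_nhds⟩
  add_mem' := by
    rintro p q ⟨F, u, hF, hu⟩ ⟨G, v, hG, hv⟩
    refine ⟨F + G, u + v, hF.add hG, fun k => ?_⟩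
    rw [map_add]
    exact ⟨(hu k).1.add (hv k).1, (hu k).2.add (hv k).2⟩
  smul_mem' := by
    rintro c p ⟨F, u, hF, hu⟩
    refine ⟨c • F, c • u, hF.smul c, fun k => ?_⟩
    rw [map_smul]
    exact ⟨(hu k).1.const_smul c, (hu k).2.const_smul c⟩

/-- The restriction of the maximal momentum operator by the boundary condition
`B (f(r k +))_k = (f(s k -))_k` in `ℓ²`. -/
def boundaryMomentum (B : unitary (BoundarySpace →L[ℂ] BoundarySpace)) : I.L2 →ₗ.[ℂ] I.L2 :=
  (I.boundaryGraph B).toLinearPMap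

theorem mem_graph_boundaryMomentum {B : unitary (BoundarySpace →L[ℂ] BoundarySpace)} {f g : I.L2} :
    (f, g) ∈ (I.boundaryMomentum B).graph ↔ ∃ (F : ℝ → ℂ) (u : BoundarySpace), I.IsRep f g F ∧
      I.HasBoundaryValues F u ((B : BoundarySpace →L[ℂ] BoundarySpace) u) := by
  rw [boundaryMomentum, Submodule.toLinearPMap_graph_eq]
  · rfl
  · rintro ⟨f, g⟩ ⟨F, u, hF, -⟩ (rfl : f = 0)
    exact hF.snd_eq_zero

/-- The momentum operator `P_B`: the closure in `L²(Ω)` of the maximal momentum operator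
restricted by the boundary condition. (Since the lengths of the intervals tend to `0`,
boundary values of functions in the domain of a closed restriction need not be square-summable,
which makes the closure necessary.) -/
def momentum (B : unitary (BoundarySpace →L[ℂ] BoundarySpace)) : I.L2 →ₗ.[ℂ] I.L2 :=
  (I.boundaryMomentum B).closure

end IntervalSystem

end

/-! For `B = 1` the boundary condition couples no two different indices. Each interval closes up to
a circle of length `ℓ_k`, and the two half-lines are glued, with the gap `[0, 1]` removed, to a full
line. So `P_B` should be the direct sum of the momentum operators of these circles and of the line.
The circles contribute the eigenvalues `ℤ / ℓ_k`, one eigenvector `exp (2πi t x)` for each `k` with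
`t ℓ_k ∈ ℤ`, and the line contributes spectrum `ℝ` without eigenvalues.

Selfadjointness is tested on the core before closure. Integration by parts gives symmetry
(`boundaryMomentum_one_isFormalAdjoint`). For non-real `z`, solving `Φ' = 2πi (z Φ + ψ)` on the
circles and on the line shows that only `0` is orthogonal to the range
(`orthogonal_range_boundaryMomentum`). Both properties pass to the closure, and the basic criterion
applies.

The domain of the closure is not described explicitly. It is only used that its elements lie in the
maximal domain, so that they solve the differential equation on each component, and that the closure
is symmetric. Periodicity of an eigenfunction on `I_k` is recovered by pairing it with the indicator
of `I_k`, an eigenvector for `0` (`exists_int_of_mem_eigenspace`).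

Every real `t` is spectral because `exp (2πi t x) / x` on `(1, ∞)` is not in the range of `P_B - t`:
a solution would grow like `log x` (`sub_smul_ne_resonance`). Eigenvectors vanish on the half-lines,
so this function also lies in the continuous subspace, and the same obstruction applies to the part
of `P_B` there. -/

namespace UnboundedOperator

open scoped InnerProductSpace

/-! ### Symmetric operators: resolvent bounds and the criterion for selfadjointness -/

section OperatorTheory

variable {H : Type*} [NormedAddCommGroup H] [InnerProductSpace ℂ H]

theorem mem_resolventSet_of_bound {T : H →ₗ.[ℂ] H} {z : ℂ} (C : ℝ)
    (hb : ∀ x : T.domain, ‖(x : H)‖ ≤ C * ‖T x - z • (x : H)‖)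
    (hs : ∀ y : H, ∃ x : T.domain, T x - z • (x : H) = y) : z ∈ resolventSet T := by
  let A : T.domain →ₗ[ℂ] H := T.toFun - z • T.domain.subtype
  have hA : ∀ x : T.domain, A x = T x - z • (x : H) := fun x => rfl
  have hinj : Function.Injective A := by
    rw [← LinearMap.ker_eq_bot, LinearMap.ker_eq_bot']
    intro x hx
    have h := hb x
    rw [← hA, hx, norm_zero, mul_zero] at h
    exact Subtype.ext (norm_le_zero_iff.1 h)
  let e : T.domain ≃ₗ[ℂ] H := LinearEquiv.ofBijective A ⟨hinj, hs⟩
  have he : ∀ y, T (e.symm y) - z • (e.symm y : H) = y := fun y => e.apply_symm_apply y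
  refine ⟨(T.domain.subtype ∘ₗ e.symm.toLinearMap).mkContinuous C fun y => ?_, fun y => ?_,
    fun x => ?_⟩
  · have h := hb (e.symm y)
    rwa [he] at h
  · exact ⟨e.symm y, rfl, he y⟩
  · have h : e.symm (e x) = x := e.symm_apply_apply x
    exact congrArg Subtype.val h

theorem mem_spectrum_of_forall_ne {T : H →ₗ.[ℂ] H} {z : ℂ} (y : H)
    (h : ∀ x : T.domain, T x - z • (x : H) ≠ y) : z ∈ spectrum T := by
  rintro ⟨R, hR, -⟩
  obtain ⟨x, -, hx⟩ := hR y
  exact h x hx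

/-- Since `⟪x, T x⟫` is real, the imaginary part of `⟪x, (T - z) x⟫` is `-z.im * ‖x‖ ^ 2`;
Cauchy–Schwarz does the rest. -/
theorem norm_le_of_symmetric {T : H →ₗ.[ℂ] H} (hT : T.IsFormalAdjoint T) {z : ℂ} (hz : z.im ≠ 0)
    (x : T.domain) : ‖(x : H)‖ ≤ |z.im|⁻¹ * ‖T x - z • (x : H)‖ := by
  have hreal : (⟪(x : H), T x⟫_ℂ).im = 0 := by
    have h := hT x x
    rw [← inner_conj_symm] at h
    exact Complex.conj_eq_iff_im.1 h
  have him : (⟪(x : H), T x - z • (x : H)⟫_ℂ).im = - (z.im * ‖(x : H)‖ ^ 2) := by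
    rw [inner_sub_right, inner_smul_right, inner_self_eq_norm_sq_to_K, Complex.sub_im, hreal]
    simp [← Complex.ofReal_pow]
  have h1 : |z.im| * ‖(x : H)‖ ^ 2 ≤ ‖(x : H)‖ * ‖T x - z • (x : H)‖ := by
    calc |z.im| * ‖(x : H)‖ ^ 2 = |(⟪(x : H), T x - z • (x : H)⟫_ℂ).im| := by
          rw [him, abs_neg, abs_mul, abs_of_nonneg (sq_nonneg ‖(x : H)‖)]
      _ ≤ ‖⟪(x : H), T x - z • (x : H)⟫_ℂ‖ := Complex.abs_im_le_norm _
      _ ≤ _ := norm_inner_le_norm _ _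
  have hpos : 0 < |z.im| := abs_pos.2 hz
  rw [le_inv_mul_iff₀ hpos]
  rcases (norm_nonneg (x : H)).eq_or_lt with h0 | h0
  · rw [← h0]; simp
  · nlinarith

/-- The graph of a closed operator is complete, and `(x, T x) ↦ T x - z x` is bounded below on it
for the graph norm. Hence its range is closed, and a trivial orthogonal complement makes it
everything. -/
theorem exists_sub_smul_eq [CompleteSpace H] {T : H →ₗ.[ℂ] H} (hT : T.IsFormalAdjoint T)
    (hc : T.IsClosed) {z : ℂ} (hz : z.im ≠ 0)
    (hr : ∀ h : H, (∀ x : T.domain, ⟪T x - z • (x : H), h⟫_ℂ = 0) → h = 0) (y : H) :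
    ∃ x : T.domain, T x - z • (x : H) = y := by
  let A : T.graph →L[ℂ] H :=
    (ContinuousLinearMap.snd ℂ H H - z • ContinuousLinearMap.fst ℂ H H) ∘L T.graph.subtypeL
  have hA : ∀ p : T.graph, A p = (p : H × H).2 - z • (p : H × H).1 := fun p => rfl
  have : CompleteSpace T.graph := hc.completeSpace_coe
  have hanti : ∃ K, AntilipschitzWith K A := by
    -- The constant dominates both components of the graph norm: `|z.im|⁻¹` serves for `x`, and `1 +
    -- ‖z‖ * |z.im|⁻¹` for `T x = (T x - z x) + z x`.
    refine ⟨NNReal.mk (1 + (1 + ‖z‖) * |z.im|⁻¹) (by positivity),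
      AddMonoidHomClass.antilipschitz_of_bound A ?_⟩
    rintro ⟨⟨x, y⟩, hp⟩
    obtain ⟨x, rfl, rfl⟩ := (LinearPMap.mem_graph_iff _).1 hp
    rw [hA, NNReal.coe_mk]
    have h1 := norm_le_of_symmetric hT hz x
    have h2 : ‖T x‖ ≤ ‖T x - z • (x : H)‖ + ‖z‖ * ‖(x : H)‖ := by
      rw [← norm_smul]
      simpa using norm_add_le (T x - z • (x : H)) (z • (x : H))
    have h3 := mul_le_mul_of_nonneg_left h1 (norm_nonneg z)
    have h4 : 0 ≤ |z.im|⁻¹ * ‖T x - z • (x : H)‖ := by positivity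
    have h5 : 0 ≤ ‖z‖ * (|z.im|⁻¹ * ‖T x - z • (x : H)‖) := by positivity
    have h6 := norm_nonneg (T x - z • (x : H))
    refine max_le (?_ : ‖(x : H)‖ ≤ _) (?_ : ‖T x‖ ≤ _)
    · linarith
    · linarith
  obtain ⟨K, hK⟩ := hanti
  have hcl : _root_.IsClosed (LinearMap.range A.toLinearMap : Set H) :=
    hK.isClosed_range A.uniformContinuous
  have htop : LinearMap.range A.toLinearMap = ⊤ := by
    rw [← hcl.submodule_topologicalClosure_eq, Submodule.topologicalClosure_eq_top_iff,
      Submodule.eq_bot_iff]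
    intro h hh
    refine hr h fun x => ?_
    exact (Submodule.mem_orthogonal _ _).1 hh _ ⟨⟨_, T.mem_graph x⟩, rfl⟩
  obtain ⟨⟨⟨a, b⟩, hp⟩, rfl⟩ := LinearMap.range_eq_top.1 htop y
  obtain ⟨x, rfl, rfl⟩ := (LinearPMap.mem_graph_iff _).1 hp
  exact ⟨x, rfl⟩

theorem im_eq_zero_of_mem_eigenspace {T : H →ₗ.[ℂ] H} (hT : T.IsFormalAdjoint T) {z : ℂ} {x : H}
    (hx : x ∈ eigenspace T z) (h0 : x ≠ 0) : z.im = 0 := by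
  by_contra hz
  obtain ⟨x, rfl, hx⟩ := mem_eigenspace.1 hx
  have := norm_le_of_symmetric hT hz x
  rw [hx, sub_self, norm_zero, mul_zero] at this
  exact h0 (norm_le_zero_iff.1 this)

/-- Closed symmetric operators for which the range of `T - z` has trivial orthogonal complement
for all non-real `z`. -/
structure IsEssentiallySurjective (T : H →ₗ.[ℂ] H) : Prop where
  symmetric : T.IsFormalAdjoint T
  closed : T.IsClosed
  orthogonal_range : ∀ z : ℂ, z.im ≠ 0 → ∀ h : H,
    (∀ x : T.domain, ⟪T x - z • (x : H), h⟫_ℂ = 0) → h = 0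

namespace IsEssentiallySurjective

variable [CompleteSpace H] {T : H →ₗ.[ℂ] H} (hT : IsEssentiallySurjective T)
include hT

theorem surj {z : ℂ} (hz : z.im ≠ 0) (y : H) : ∃ x : T.domain, T x - z • (x : H) = y :=
  exists_sub_smul_eq hT.symmetric hT.closed hz (hT.orthogonal_range z hz) y

/-- A vector orthogonal to the domain has the form `T x - i x`; pairing it with `x` and taking
imaginary parts gives `‖x‖ = 0`. -/
theorem dense_domain : Dense (T.domain : Set H) := by
  rw [Submodule.dense_iff_topologicalClosure_eq_top, Submodule.topologicalClosure_eq_top_iff,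
    Submodule.eq_bot_iff]
  intro h hh
  obtain ⟨x, rfl⟩ := hT.surj (z := Complex.I) (by simp) h
  have h0 : ⟪(x : H), T x - Complex.I • (x : H)⟫_ℂ = 0 :=
    (Submodule.mem_orthogonal _ _).1 hh _ x.2
  have hreal : (⟪(x : H), T x⟫_ℂ).im = 0 := by
    have h := hT.symmetric x x
    rw [← inner_conj_symm] at h
    exact Complex.conj_eq_iff_im.1 h
  have him := congrArg Complex.im h0
  rw [inner_sub_right, inner_smul_right, inner_self_eq_norm_sq_to_K, Complex.sub_im, hreal] at him
  have hx : x = 0 := by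
    have : ‖(x : H)‖ = 0 := by simpa [← Complex.ofReal_pow] using him
    exact Subtype.ext (norm_eq_zero.1 this)
  simp [hx]

/-- For `y` in the domain of the adjoint, solve `(T - i) x = (T* - i) y`. Then `y - x` is orthogonal
to the range of `T + i`, so `y = x` is in the domain of `T`. -/
theorem isSelfAdjoint : IsSelfAdjoint T := by
  have hd := hT.dense_domain
  have hle : T ≤ LinearPMap.adjoint T := LinearPMap.IsFormalAdjoint.le_adjoint hd hT.symmetric
  rw [LinearPMap.isSelfAdjoint_def]
  refine (LinearPMap.eq_of_le_of_domain_eq hle (le_antisymm hle.1 fun y hy => ?_)).symm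
  obtain ⟨x, hx⟩ := hT.surj (z := Complex.I) (by simp)
    (LinearPMap.adjoint T ⟨y, hy⟩ - Complex.I • y)
  have h0 : y - x = 0 := by
    refine hT.orthogonal_range (-Complex.I) (by simp) _ fun w => ?_
    have h1 := LinearPMap.adjoint_isFormalAdjoint hd ⟨y, hy⟩ w
    have h2 := hT.symmetric x w
    have h3 : ⟪T x - Complex.I • (x : H), (w : H)⟫_ℂ
        = ⟪LinearPMap.adjoint T ⟨y, hy⟩ - Complex.I • y, (w : H)⟫_ℂ := by rw [hx]
    rw [← inner_conj_symm]
    simp only [inner_sub_left, inner_smul_left, inner_sub_right, inner_smul_right, h1, h2] at h3 ⊢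
    rw [map_eq_zero]
    simp at h3 ⊢
    linear_combination -h3
  rw [sub_eq_zero.1 h0]
  exact x.2

theorem spectrum_subset : spectrum T ⊆ Set.range (fun t : ℝ => (t : ℂ)) := by
  intro z hz
  by_contra h
  have him : z.im ≠ 0 := fun h0 => h ⟨z.re, by apply Complex.ext <;> simp [h0]⟩
  exact hz (mem_resolventSet_of_bound _ (norm_le_of_symmetric hT.symmetric him) (hT.surj him))

/-- The solution `x` of `(T - z) x = y` stays in the continuous subspace when `y` lies there: for an
eigenvector `v` with real eigenvalue `w`, symmetry gives `(w - z) ⟪v, x⟫ = ⟪v, y⟫ = 0`, and `w ≠ z`.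
-/
theorem continuousSpectrum_subset :
    continuousSpectrum T ⊆ Set.range (fun t : ℝ => (t : ℂ)) := by
  intro z hz
  by_contra h
  have him : z.im ≠ 0 := fun h0 => h ⟨z.re, by apply Complex.ext <;> simp [h0]⟩
  refine hz (mem_resolventSet_of_bound |z.im|⁻¹ (fun x => ?_) fun y => ?_)
  · have hg := mem_graph_part.1 ((part T (continuousSubspace T)).mem_graph x)
    obtain ⟨x', hx1, hx2⟩ := (LinearPMap.mem_graph_iff _).1 hg
    have := norm_le_of_symmetric hT.symmetric him x'
    rw [hx1, hx2] at this
    exact this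
  · obtain ⟨x, hx⟩ := hT.surj him (y : H)
    have hxK : (x : H) ∈ continuousSubspace T := by
      rw [continuousSubspace, Submodule.mem_orthogonal]
      intro v hv
      refine Submodule.iSup_induction (motive := fun v => ⟪v, (x : H)⟫_ℂ = 0) _ hv ?_ ?_ ?_
      · intro w v hv
        by_cases h0 : v = 0
        · simp [h0]
        have hw := im_eq_zero_of_mem_eigenspace hT.symmetric hv h0
        have hy : ⟪v, (y : H)⟫_ℂ = 0 :=
          (Submodule.mem_orthogonal _ _).1 y.2 v (Submodule.mem_iSup_of_mem w hv)
        obtain ⟨v, rfl, hv⟩ := mem_eigenspace.1 hv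
        rw [← hx, inner_sub_right, ← hT.symmetric v x, hv, inner_smul_left, inner_smul_right,
          ← sub_mul, mul_eq_zero] at hy
        refine hy.resolve_left fun h => him ?_
        rw [← sub_eq_zero.1 h]
        simp [hw]
      · simp
      · intro a b ha hb
        rw [inner_add_left, ha, hb, add_zero]
    have hTK : T x ∈ continuousSubspace T := by
      rw [← sub_add_cancel (T x) (z • (x : H)), hx]
      exact Submodule.add_mem _ y.2 (Submodule.smul_mem _ _ hxK)
    have hg : ((⟨x, hxK⟩, ⟨T x, hTK⟩) : _ × _) ∈ (part T (continuousSubspace T)).graph :=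
      mem_graph_part.2 (T.mem_graph x)
    obtain ⟨x', h1, h2⟩ := (LinearPMap.mem_graph_iff _).1 hg
    refine ⟨x', ?_⟩
    rw [h2, h1]
    exact Subtype.ext hx

end IsEssentiallySurjective

/-- It suffices to check symmetry and density of ranges on a core. -/
theorem isEssentiallySurjective_closure {S : H →ₗ.[ℂ] H} (hc : S.IsClosable)
    (hs : S.IsFormalAdjoint S)
    (hr : ∀ z : ℂ, z.im ≠ 0 → ∀ h : H, (∀ x : S.domain, ⟪S x - z • (x : H), h⟫_ℂ = 0) → h = 0) :
    IsEssentiallySurjective S.closure where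
  closed := hc.closure_isClosed
  symmetric := by
    have hcl : ∀ p ∈ S.closure.graph, ∀ q ∈ S.closure.graph,
        ⟪p.2, q.1⟫_ℂ = ⟪p.1, q.2⟫_ℂ := by
      rw [← hc.graph_closure_eq_closure_graph]
      have h1 : ∀ p ∈ S.graph, ∀ q ∈ S.graph.topologicalClosure,
          ⟪p.2, q.1⟫_ℂ = ⟪p.1, q.2⟫_ℂ := by
        intro p hp q hq
        refine closure_minimal (s := (S.graph : Set (H × H)))
          (t := {q | ⟪p.2, q.1⟫_ℂ = ⟪p.1, q.2⟫_ℂ}) ?_ (isClosed_eq (by fun_prop) (by fun_prop)) hq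
        intro q hq
        obtain ⟨x, h1, h2⟩ := (LinearPMap.mem_graph_iff _).1 hp
        obtain ⟨y, h3, h4⟩ := (LinearPMap.mem_graph_iff _).1 hq
        rw [mem_ofPred_eq, ← h1, ← h2, ← h3, ← h4]
        exact hs x y
      intro p hp q hq
      exact closure_minimal (s := (S.graph : Set (H × H)))
        (t := {p | ⟪p.2, q.1⟫_ℂ = ⟪p.1, q.2⟫_ℂ}) (fun p hp => h1 p hp q hq)
        (isClosed_eq (by fun_prop) (by fun_prop)) hp
    exact fun x y => hcl _ (S.closure.mem_graph x) _ (S.closure.mem_graph y)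
  orthogonal_range z hz h hh := by
    refine hr z hz h fun x => ?_
    have hle := S.le_closure
    have := hh ⟨x, hle.1 x.2⟩
    rwa [← hle.2 (x := x) (y := ⟨x, hle.1 x.2⟩) rfl] at this

end OperatorTheory

end UnboundedOperator

/-! ### Absolutely continuous complex-valued functions -/

section AbsolutelyContinuous

theorem absolutelyContinuousOnInterval_const {X : Type*} [PseudoMetricSpace X] (c : X) (a b : ℝ) :
    AbsolutelyContinuousOnInterval (fun _ : ℝ => c) a b :=
  (LipschitzWith.const c).lipschitzOnWith.absolutelyContinuousOnInterval (K := 0)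

theorem AbsolutelyContinuousOnInterval.congr {X : Type*} [PseudoMetricSpace X] {f g : ℝ → X}
    {a b : ℝ} (hf : AbsolutelyContinuousOnInterval f a b) (h : EqOn g f (uIcc a b)) :
    AbsolutelyContinuousOnInterval g a b := by
  rw [absolutelyContinuousOnInterval_iff] at hf ⊢
  intro ε hε
  obtain ⟨δ, hδ, hE⟩ := hf ε hε
  refine ⟨δ, hδ, fun E hm hlt => ?_⟩
  rw [Finset.sum_congr rfl fun i hi => ?_]
  · exact hE E hm hlt
  · rw [h (hm.1 i hi).1, h (hm.1 i hi).2]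

theorem AbsolutelyContinuousOnInterval.of_re_im {F : ℝ → ℂ} {a b : ℝ}
    (hr : AbsolutelyContinuousOnInterval (fun x => (F x).re) a b)
    (hi : AbsolutelyContinuousOnInterval (fun x => (F x).im) a b) :
    AbsolutelyContinuousOnInterval F a b := by
  have h := (hr.fun_smul (absolutelyContinuousOnInterval_const (1 : ℂ) a b)).fun_add
    (hi.fun_smul (absolutelyContinuousOnInterval_const Complex.I a b))
  refine h.congr fun x _ => ?_
  simp

theorem IntervalIntegrable.absolutelyContinuousOnInterval_complex {f : ℝ → ℂ} {a b c : ℝ}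
    (h : IntervalIntegrable f volume a b) (hc : c ∈ uIcc a b) :
    AbsolutelyContinuousOnInterval (fun x => ∫ t in c..x, f t) a b := by
  have hre : IntervalIntegrable (fun x => (f x).re) volume a b := ⟨h.1.re, h.2.re⟩
  have him : IntervalIntegrable (fun x => (f x).im) volume a b := ⟨h.1.im, h.2.im⟩
  have hsub : ∀ x ∈ uIcc a b, IntervalIntegrable f volume c x := fun x hx =>
    h.mono_set (uIcc_subset_uIcc hc hx)
  refine .of_re_im ((hre.absolutelyContinuousOnInterval_intervalIntegral hc).congr fun x hx => ?_)
    ((him.absolutelyContinuousOnInterval_intervalIntegral hc).congr fun x hx => ?_)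
  · exact (Complex.reCLM.intervalIntegral_comp_comm (hsub x hx)).symm
  · exact (Complex.imCLM.intervalIntegral_comp_comm (hsub x hx)).symm

/-- `F` minus the primitive of `f` is absolutely continuous with derivative zero almost everywhere,
hence constant. -/
theorem AbsolutelyContinuousOnInterval.integral_eq_sub_of_ae_hasDerivAt {F f : ℝ → ℂ} {a b : ℝ}
    (hF : AbsolutelyContinuousOnInterval F a b) (hf : IntervalIntegrable f volume a b)
    (h : ∀ᵐ x, x ∈ uIcc a b → HasDerivAt F (f x) x) : ∫ t in a..b, f t = F b - F a := by
  have hG := hF.fun_sub (hf.absolutelyContinuousOnInterval_complex left_mem_uIcc)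
  obtain ⟨C, hC⟩ := hG.const_of_ae_hasDerivAt_zero (by
    filter_upwards [h, hf.ae_hasDerivAt_integral] with x h1 h2 hx
    have h3 := (h1 hx).sub (h2 hx a left_mem_uIcc)
    rwa [sub_self] at h3)
  have ha := hC a left_mem_uIcc
  have hb := hC b right_mem_uIcc
  rw [intervalIntegral.integral_same] at ha
  linear_combination ha - hb

end AbsolutelyContinuous

/-! ### Closedness of the maximal momentum operator -/

namespace IntervalSystem

variable {I : IntervalSystem}

open scoped InnerProductSpace

theorem restrict_restrict_Ω {s : Set ℝ} (hs : s ⊆ I.Ω) (hm : MeasurableSet s) :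
    (volume.restrict I.Ω).restrict s = volume.restrict s := by
  rw [Measure.restrict_restrict hm, inter_eq_left.2 hs]

theorem L2.memLp {s : Set ℝ} (g : I.L2) (hs : s ⊆ I.Ω) : MemLp g 2 (volume.restrict s) :=
  (Lp.memLp g).mono_measure (Measure.restrict_mono_set _ hs)

theorem L2.integrableOn {s : Set ℝ} (g : I.L2) (hs : s ⊆ I.Ω) (hfin : volume s ≠ ⊤) :
    IntegrableOn g s := by
  have : IsFiniteMeasure (volume.restrict s) := ⟨by
    rw [Measure.restrict_apply_univ]; exact hfin.lt_top⟩
  exact (L2.memLp g hs).integrable one_le_two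

theorem L2.intervalIntegrable {a b : ℝ} (g : I.L2) (hs : Icc a b ⊆ I.Ω) (hab : a ≤ b) :
    IntervalIntegrable g volume a b := by
  rw [intervalIntegrable_iff_integrableOn_Icc_of_le hab]
  exact L2.integrableOn g hs measure_Icc_lt_top.ne

theorem continuous_setIntegral {s : Set ℝ} (hs : s ⊆ I.Ω) (hm : MeasurableSet s)
    (hfin : volume s ≠ ⊤) : Continuous fun g : I.L2 => ∫ x in s, g x := by
  have hfin' : volume.restrict I.Ω s ≠ ⊤ :=
    ((Measure.restrict_apply_le _ _).trans_lt hfin.lt_top).ne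
  have h : (fun g : I.L2 => ∫ x in s, g x)
      = fun g : I.L2 => ⟪indicatorConstLp 2 hm hfin' (1 : ℂ), g⟫_ℂ := by
    ext g
    rw [L2.inner_indicatorConstLp_one, restrict_restrict_Ω hs hm]
  rw [h]
  fun_prop

theorem ae_restrict_Ω_iff {p : ℝ → Prop} :
    (∀ᵐ x ∂(volume.restrict I.Ω), p x) ↔ ∀ᵐ x, x ∈ I.Ω → p x :=
  ae_restrict_iff' isOpen_Ω.measurableSet

theorem IsRep.sub_eq_integral {f g : I.L2} {F : ℝ → ℂ} (h : I.IsRep f g F) {a b : ℝ}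
    (hab : a ≤ b) (hs : Icc a b ⊆ I.Ω) :
    F b - F a = 2 * Real.pi * Complex.I * ∫ t in a..b, g t := by
  rw [← intervalIntegral.integral_const_mul]
  refine ((h.absCont a b hab hs).integral_eq_sub_of_ae_hasDerivAt
    ((L2.intervalIntegrable g hs hab).const_mul _) ?_).symm
  filter_upwards [ae_restrict_Ω_iff.1 h.hasDeriv] with x hx hxab
  rw [uIcc_of_le hab] at hxab
  exact hx (hs hxab)

theorem exists_rat_Icc_subset_Ω {x : ℝ} (hx : x ∈ I.Ω) :
    ∃ p q : ℚ, x ∈ Ioo (p : ℝ) q ∧ Icc (p : ℝ) q ⊆ I.Ω := by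
  obtain ⟨ε, hε, hb⟩ := Metric.isOpen_iff.1 (isOpen_Ω (I := I)) x hx
  obtain ⟨p, hp1, hp2⟩ := exists_rat_btwn (show x - ε < x by linarith)
  obtain ⟨q, hq1, hq2⟩ := exists_rat_btwn (show x < x + ε by linarith)
  refine ⟨p, q, ⟨hp2, hq1⟩, fun y hy => hb ?_⟩
  rw [Metric.mem_ball, Real.dist_eq, abs_lt]
  constructor <;> linarith [hy.1, hy.2]

/-- Lebesgue differentiation holds almost everywhere on each compact interval in `Ω`. Rational
endpoints suffice to cover `Ω`, so only countably many null sets are discarded. -/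
theorem IsRep.of_sub_eq_integral {f g : I.L2} {F : ℝ → ℂ} (hf : f =ᵐ[volume.restrict I.Ω] F)
    (h : ∀ a b : ℝ, a ≤ b → Icc a b ⊆ I.Ω →
      F b - F a = 2 * Real.pi * Complex.I * ∫ t in a..b, g t) : I.IsRep f g F := by
  have hF : ∀ a b : ℝ, a ≤ b → Icc a b ⊆ I.Ω → ∀ x ∈ Icc a b,
      F x = F a + 2 * Real.pi * Complex.I * ∫ t in a..x, g t := by
    intro a b hab hs x hx
    rw [← h a x hx.1 ((Icc_subset_Icc_right hx.2).trans hs)]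
    ring
  refine ⟨hf, fun a b hab hs => ?_, ?_⟩
  · have h1 := (((L2.intervalIntegrable g hs hab).absolutelyContinuousOnInterval_complex
      left_mem_uIcc).const_smul (2 * Real.pi * Complex.I)).fun_add
      (absolutelyContinuousOnInterval_const (F a) a b)
    refine h1.congr fun x hx => ?_
    rw [uIcc_of_le hab] at hx
    rw [hF a b hab hs x hx, add_comm]
    rfl
  · rw [ae_restrict_Ω_iff]
    have h1 : ∀ p q : ℚ, ∀ᵐ x : ℝ, (x ∈ Ioo (p : ℝ) q ∧ Icc (p : ℝ) q ⊆ I.Ω) →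
        HasDerivAt F (2 * Real.pi * Complex.I * g x) x := by
      intro p q
      by_cases hs : Icc (p : ℝ) q ⊆ I.Ω
      swap
      · exact Eventually.of_forall fun x hx => absurd hx.2 hs
      rcases le_or_gt (p : ℝ) q with hpq | hpq
      swap
      · exact Eventually.of_forall fun x hx => absurd (hx.1.1.trans hx.1.2) hpq.not_gt
      filter_upwards [(L2.intervalIntegrable g hs hpq).ae_hasDerivAt_integral] with x hx hxpq
      have hxI : x ∈ uIcc (p : ℝ) q := by
        rw [uIcc_of_le hpq]; exact Ioo_subset_Icc_self hxpq.1
      have h2 := ((hx hxI p left_mem_uIcc).const_mul (2 * Real.pi * Complex.I)).const_add (F p)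
      refine h2.congr_of_eventuallyEq ?_
      filter_upwards [Ioo_mem_nhds hxpq.1.1 hxpq.1.2] with y hy
      exact hF p q hpq hs y (Ioo_subset_Icc_self hy)
    filter_upwards [ae_all_iff.2 fun p => ae_all_iff.2 (h1 p)] with x hx hxΩ
    obtain ⟨p, q, h2, h3⟩ := exists_rat_Icc_subset_Ω hxΩ
    exact hx p q ⟨h2, h3⟩

/-- Along a subsequence the representatives converge almost everywhere. Their increments over
compact intervals in `Ω` converge too, being integrals of an `L²`-convergent sequence. Convergence
at one nearby point therefore spreads to every point of `Ω`, and the limit satisfies the integral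
equation. -/
theorem isClosed_maxGraph : IsClosed (I.maxGraph : Set (I.L2 × I.L2)) := by
  refine isClosed_of_closure_subset fun p hp => ?_
  obtain ⟨u, hu, hup⟩ := mem_closure_iff_seq_limit.1 hp
  have hu1 : Tendsto (fun n => (u n).1) atTop (𝓝 p.1) := (continuous_fst.tendsto p).comp hup
  have hu2 : Tendsto (fun n => (u n).2) atTop (𝓝 p.2) := (continuous_snd.tendsto p).comp hup
  obtain ⟨φ, hφ, hae⟩ := (tendstoInMeasure_of_tendsto_Lp hu1).exists_seq_tendsto_ae
  choose F hF using hu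
  have hint : ∀ a b : ℝ, a ≤ b → Icc a b ⊆ I.Ω → Tendsto (fun n => F (φ n) b - F (φ n) a) atTop
      (𝓝 (2 * Real.pi * Complex.I * ∫ t in a..b, p.2 t)) := by
    intro a b hab hs
    have h1 : ∀ n, F (φ n) b - F (φ n) a
        = 2 * Real.pi * Complex.I * ∫ t in Ioc a b, (u (φ n)).2 t := fun n => by
      rw [(hF (φ n)).sub_eq_integral hab hs, intervalIntegral.integral_of_le hab]
    simp_rw [h1, intervalIntegral.integral_of_le hab]
    refine Tendsto.const_mul _ ?_
    exact ((continuous_setIntegral (Ioc_subset_Icc_self.trans hs) measurableSet_Ioc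
      measure_Ioc_lt_top.ne).tendsto p.2).comp (hu2.comp hφ.tendsto_atTop)
  have hpt : ∀ᵐ x ∂(volume.restrict I.Ω), Tendsto (fun n => F (φ n) x) atTop (𝓝 (p.1 x)) := by
    filter_upwards [hae, ae_all_iff.2 fun n => (hF n).ae_eq] with x hx h2
    simpa only [h2] using hx
  have hconv : ∀ x ∈ I.Ω, ∃ c, Tendsto (fun n => F (φ n) x) atTop (𝓝 c) := by
    intro x hx
    obtain ⟨a, b, hxab, hs⟩ := exists_rat_Icc_subset_Ω hx
    have hlt : (a : ℝ) < x := hxab.1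
    have hne : (volume.restrict (Ioo (a : ℝ) x)) ≠ 0 := by
      rw [Ne, Measure.restrict_eq_zero, Real.volume_Ioo]
      simpa using hlt
    have hsub : Ioo (a : ℝ) x ⊆ I.Ω := fun y hy => hs ⟨hy.1.le, hy.2.le.trans hxab.2.le⟩
    have : (ae (volume.restrict (Ioo (a : ℝ) x))).NeBot := ae_neBot.2 hne
    obtain ⟨y, hy, hyI⟩ := ((ae_restrict_of_ae_restrict_of_subset hsub hpt).and
      (ae_restrict_mem measurableSet_Ioo)).exists
    have h := (hint y x hyI.2.le fun w hw => hs ⟨hyI.1.le.trans hw.1, hw.2.trans hxab.2.le⟩).add hy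
    simp only [sub_add_cancel] at h
    exact ⟨_, h⟩
  choose! G hG using hconv
  refine ⟨G, IsRep.of_sub_eq_integral ?_ fun a b hab hs => ?_⟩
  · filter_upwards [hpt, ae_restrict_mem isOpen_Ω.measurableSet] with x hx hxΩ
    exact tendsto_nhds_unique hx (hG x hxΩ)
  · exact tendsto_nhds_unique ((hG b (hs (right_mem_Icc.2 hab))).sub
      (hG a (hs (left_mem_Icc.2 hab)))) (hint a b hab hs)

theorem graph_maximalMomentum : I.maximalMomentum.graph = I.maxGraph := by
  ext ⟨f, g⟩
  exact mem_graph_maximalMomentum I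

theorem maximalMomentum_isClosed : I.maximalMomentum.IsClosed := by
  rw [LinearPMap.IsClosed, graph_maximalMomentum]
  exact isClosed_maxGraph

theorem boundaryMomentum_le (B : unitary (BoundarySpace →L[ℂ] BoundarySpace)) :
    I.boundaryMomentum B ≤ I.maximalMomentum := by
  refine LinearPMap.le_of_le_graph ?_
  rintro ⟨f, g⟩ h
  obtain ⟨F, -, hF, -⟩ := (mem_graph_boundaryMomentum I).1 h
  exact (mem_graph_maximalMomentum I).2 ⟨F, hF⟩

theorem boundaryMomentum_isClosable (B : unitary (BoundarySpace →L[ℂ] BoundarySpace)) :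
    (I.boundaryMomentum B).IsClosable :=
  maximalMomentum_isClosed.isClosable.leIsClosable (boundaryMomentum_le B)

/-- The closure cannot leave the closed maximal operator. This supplies locally absolutely
continuous representatives for the elements of its domain. -/
theorem momentum_le (B : unitary (BoundarySpace →L[ℂ] BoundarySpace)) :
    I.momentum B ≤ I.maximalMomentum := by
  have h := maximalMomentum_isClosed.isClosable.closure_mono (boundaryMomentum_le (I := I) B)
  refine h.trans_eq (LinearPMap.eq_of_eq_graph ?_)
  rw [← maximalMomentum_isClosed.isClosable.graph_closure_eq_closure_graph]
  exact maximalMomentum_isClosed.submodule_topologicalClosure_eq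

end IntervalSystem

/-! ### Integration by parts and symmetry -/

/-- The filters `l₁` and `l₂` stand for the two ends of `J`, so that bounded intervals and
half-lines are handled alike: the intervals `Icc a b` with `a` along `l₁` and `b` along `l₂` exhaust
`J`. -/
theorem setIntegral_eq_sub_of_tendsto {J : Set ℝ} (hJ : MeasurableSet J) {l₁ l₂ : Filter ℝ}
    [l₁.NeBot] [l₂.NeBot] [l₁.IsCountablyGenerated] [l₂.IsCountablyGenerated]
    (h₁ : ∀ x ∈ J, ∀ᶠ a in l₁, a ∈ J ∧ a ≤ x) (h₂ : ∀ x ∈ J, ∀ᶠ b in l₂, b ∈ J ∧ x ≤ b)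
    (hne : J.Nonempty) (hc : J.OrdConnected) {W k : ℝ → ℂ} (hk : IntegrableOn k J)
    (hW : ∀ a ∈ J, ∀ b ∈ J, a ≤ b → ∫ x in a..b, k x = W b - W a) {A B : ℂ}
    (hA : Tendsto W l₁ (𝓝 A)) (hB : Tendsto W l₂ (𝓝 B)) : ∫ x in J, k x = B - A := by
  have hcov : AECover (volume.restrict J) (l₁ ×ˢ l₂) fun i => Icc i.1 i.2 :=
    ⟨(ae_restrict_mem hJ).mono fun x hx =>
      (((h₁ x hx).prod_inl l₂).and ((h₂ x hx).prod_inr l₁)).mono fun i hi => ⟨hi.1.2, hi.2.2⟩,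
      fun i => measurableSet_Icc⟩
  obtain ⟨x₀, hx₀⟩ := hne
  have h1 := hcov.integral_tendsto_of_countably_generated hk
  have h2 : Tendsto (fun i : ℝ × ℝ => W i.2 - W i.1) (l₁ ×ˢ l₂) (𝓝 (B - A)) :=
    (hB.comp tendsto_snd).sub (hA.comp tendsto_fst)
  refine tendsto_nhds_unique (h1.congr' ?_) h2
  filter_upwards [((h₁ x₀ hx₀).prod_inl l₂).and ((h₂ x₀ hx₀).prod_inr l₁)] with i hi
  have hle := hi.1.2.trans hi.2.2
  rw [← hW _ hi.1.1 _ hi.2.1 hle, intervalIntegral.integral_of_le hle, ← integral_Icc_eq_integral_Ioc,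
    Measure.restrict_restrict measurableSet_Icc, inter_eq_left.2 (hc.out hi.1.1 hi.2.1)]

/-- Integrability of `k` makes `W` converge at infinity; integrability of `W` excludes a nonzero
limit. -/
theorem tendsto_atTop_zero_of_integral_eq_sub {r : ℝ} {W k : ℝ → ℂ}
    (hk : IntegrableOn k (Ioi r)) (hWi : IntegrableOn W (Ioi r))
    (hW : ∀ a ∈ Ioi r, ∀ b ∈ Ioi r, a ≤ b → ∫ x in a..b, k x = W b - W a) :
    Tendsto W atTop (𝓝 0) := by
  have hr : r < r + 1 := lt_add_one r
  have h1 := (intervalIntegral_tendsto_integral_Ioi (r + 1)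
    (hk.mono_set (Ioi_subset_Ioi hr.le)) tendsto_id).const_add (W (r + 1))
  have h2 : Tendsto W atTop (𝓝 (W (r + 1) + ∫ x in Ioi (r + 1), k x)) := by
    refine h1.congr' ?_
    filter_upwards [eventually_ge_atTop (r + 1)] with b hb
    rw [id, hW _ hr b (hr.trans_le hb) hb]
    ring
  rwa [IntegrableAtFilter.eq_zero_of_tendsto ⟨_, Ioi_mem_atTop r, hWi⟩ (fun s hs => ?_) h2] at h2
  obtain ⟨b, hb⟩ := mem_atTop_sets.1 hs
  rw [← top_le_iff, ← Real.volume_Ici (a := b)]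
  exact measure_mono hb

theorem tendsto_atBot_zero_of_integral_eq_sub {s : ℝ} {W k : ℝ → ℂ}
    (hk : IntegrableOn k (Iio s)) (hWi : IntegrableOn W (Iio s))
    (hW : ∀ a ∈ Iio s, ∀ b ∈ Iio s, a ≤ b → ∫ x in a..b, k x = W b - W a) :
    Tendsto W atBot (𝓝 0) := by
  have hr : s - 1 < s := sub_one_lt s
  have h1 := (intervalIntegral_tendsto_integral_Iic (s - 1)
    (hk.mono_set (Iic_subset_Iio.2 hr)) tendsto_id).const_sub (W (s - 1))
  have h2 : Tendsto W atBot (𝓝 (W (s - 1) - ∫ x in Iic (s - 1), k x)) := by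
    refine h1.congr' ?_
    filter_upwards [eventually_le_atBot (s - 1)] with b hb
    rw [id, hW b (hb.trans_lt hr) _ hr hb]
    ring
  rwa [IntegrableAtFilter.eq_zero_of_tendsto ⟨_, Iio_mem_atBot s, hWi⟩ (fun t ht => ?_) h2] at h2
  obtain ⟨b, hb⟩ := mem_atBot_sets.1 ht
  rw [← top_le_iff, ← Real.volume_Iic (a := b)]
  exact measure_mono hb

theorem AbsolutelyContinuousOnInterval.conj {F : ℝ → ℂ} {a b : ℝ}
    (hF : AbsolutelyContinuousOnInterval F a b) :
    AbsolutelyContinuousOnInterval (fun x => starRingEnd ℂ (F x)) a b := by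
  rw [absolutelyContinuousOnInterval_iff] at hF ⊢
  simpa only [Complex.dist_conj_conj] using hF

namespace IntervalSystem

variable {I : IntervalSystem}

open scoped InnerProductSpace

theorem Iio_subset_Ω : Iio 0 ⊆ I.Ω := fun _ hx => Or.inl (Or.inl hx)

theorem Ioi_subset_Ω : Ioi 1 ⊆ I.Ω := fun _ hx => Or.inl (Or.inr hx)

theorem Ioo_subset_Ω {k : ℕ} (hk : 1 ≤ k) : Ioo (I.r k) (I.s k) ⊆ I.Ω :=
  fun _ hx => Or.inr (mem_iUnion₂.2 ⟨k, hk, hx⟩)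

theorem setIntegral_Ω_eq_zero {φ : ℝ → ℂ} (hφ : IntegrableOn φ I.Ω)
    (h0 : (∫ x in Iio 0, φ x) + ∫ x in Ioi 1, φ x = 0)
    (hk : ∀ k, 1 ≤ k → ∫ x in Ioo (I.r k) (I.s k), φ x = 0) : ∫ x in I.Ω, φ x = 0 := by
  have hU : (⋃ (k : ℕ) (_ : 1 ≤ k), Ioo (I.r k) (I.s k))
      = ⋃ k : {k : ℕ // 1 ≤ k}, Ioo (I.r k) (I.s k) := by
    rw [iUnion_subtype]
  have hsub : (⋃ k : {k : ℕ // 1 ≤ k}, Ioo (I.r k) (I.s k)) ⊆ Ioo 0 1 :=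
    iUnion_subset fun k => I.subset_unit k k.2
  have hΩ : I.Ω = (Iio 0 ∪ Ioi 1) ∪ ⋃ k : {k : ℕ // 1 ≤ k}, Ioo (I.r k) (I.s k) := by
    rw [Ω, hU]
  have hm : MeasurableSet (⋃ k : {k : ℕ // 1 ≤ k}, Ioo (I.r k) (I.s k)) :=
    MeasurableSet.iUnion fun _ => measurableSet_Ioo
  have hd1 : Disjoint (Iio (0 : ℝ) ∪ Ioi 1) (⋃ k : {k : ℕ // 1 ≤ k}, Ioo (I.r k) (I.s k)) := by
    refine Disjoint.mono_right hsub ?_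
    rw [Set.disjoint_left]
    rintro x (hx | hx) hx'
    · exact lt_asymm hx hx'.1
    · exact lt_asymm hx hx'.2
  have hd2 : Disjoint (Iio (0 : ℝ)) (Ioi 1) := by
    rw [Set.disjoint_left]
    intro x (hx : x < 0) (hx' : 1 < x)
    linarith
  rw [hΩ] at hφ ⊢
  rw [setIntegral_union hd1 hm hφ.left_of_union hφ.right_of_union,
    setIntegral_union hd2 measurableSet_Ioi hφ.left_of_union.left_of_union
      hφ.left_of_union.right_of_union, h0, zero_add,
    integral_iUnion (s := fun k : {k : ℕ // 1 ≤ k} => Ioo (I.r k) (I.s k))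
      (fun _ => measurableSet_Ioo)
      (fun k l hkl => I.disjoint k l k.2 l.2 fun h => hkl (Subtype.ext h)) hφ.right_of_union]
  simp [fun k : {k : ℕ // 1 ≤ k} => hk k k.2]

/-- The integrand is the derivative of `conj F * F'`; the minus sign comes from conjugating `2πi`.
-/
theorem IsRep.integral_inner_sub {f g f' g' : I.L2} {F F' : ℝ → ℂ} (h : I.IsRep f g F)
    (h' : I.IsRep f' g' F') {a b : ℝ} (hab : a ≤ b) (hs : Icc a b ⊆ I.Ω) :
    ∫ x in a..b, 2 * Real.pi * Complex.I * (⟪f x, g' x⟫_ℂ - ⟪g x, f' x⟫_ℂ)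
      = starRingEnd ℂ (F b) * F' b - starRingEnd ℂ (F a) * F' a := by
  have hac := (h.absCont a b hab hs).conj.fun_smul (h'.absCont a b hab hs)
  refine hac.integral_eq_sub_of_ae_hasDerivAt ?_ ?_
  · refine IntervalIntegrable.const_mul ?_ _
    rw [intervalIntegrable_iff_integrableOn_Icc_of_le hab]
    exact (IntegrableOn.mono_set (L2.integrable_inner f g') hs).sub
      (IntegrableOn.mono_set (L2.integrable_inner g f') hs)
  · filter_upwards [ae_restrict_Ω_iff.1 h.hasDeriv, ae_restrict_Ω_iff.1 h'.hasDeriv,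
      ae_restrict_Ω_iff.1 h.ae_eq, ae_restrict_Ω_iff.1 h'.ae_eq] with x h1 h2 h3 h4 hx
    rw [uIcc_of_le hab] at hx
    have hxΩ := hs hx
    have h5 : HasDerivAt (fun y => starRingEnd ℂ (F y))
        (starRingEnd ℂ (2 * Real.pi * Complex.I * g x)) x :=
      (Complex.conjCLE : ℂ →L[ℝ] ℂ).hasFDerivAt.comp_hasDerivAt x (h1 hxΩ)
    refine (h5.mul (h2 hxΩ)).congr_deriv ?_
    rw [h3 hxΩ, h4 hxΩ]
    simp only [RCLike.inner_apply, map_mul, Complex.conj_ofReal, Complex.conj_I, map_ofNat]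
    ring

/-- With `B = 1` the product `W = conj F * G` has equal limits at `r k` and `s k`, so each bounded
interval contributes nothing. As `W` vanishes at `±∞`, the half-lines contribute `W(0⁻)` and
`-W(1⁺)`, which cancel. -/
theorem boundaryMomentum_one_isFormalAdjoint :
    (I.boundaryMomentum 1).IsFormalAdjoint (I.boundaryMomentum 1) := by
  intro p q
  obtain ⟨F, u, hF, hu⟩ := (mem_graph_boundaryMomentum I).1 ((I.boundaryMomentum 1).mem_graph p)
  obtain ⟨G, v, hG, hv⟩ := (mem_graph_boundaryMomentum I).1 ((I.boundaryMomentum 1).mem_graph q)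
  set f : I.L2 := p.1
  set f' : I.L2 := q.1
  set g := I.boundaryMomentum 1 p
  set g' := I.boundaryMomentum 1 q
  simp only [OneMemClass.coe_one, one_apply_eq_self] at hu hv
  let W : ℝ → ℂ := fun x => starRingEnd ℂ (F x) * G x
  let κ : ℝ → ℂ := fun x => 2 * Real.pi * Complex.I * (⟪f x, g' x⟫_ℂ - ⟪g x, f' x⟫_ℂ)
  have hκ : IntegrableOn κ I.Ω :=
    ((L2.integrable_inner f g').sub (L2.integrable_inner g f')).const_mul _
  have hWi : IntegrableOn W I.Ω := by
    refine (L2.integrable_inner f f' (𝕜 := ℂ)).congr ?_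
    filter_upwards [hF.ae_eq, hG.ae_eq] with x h1 h2
    rw [h1, h2, RCLike.inner_apply, mul_comm]
  have hW : ∀ J : Set ℝ, J ⊆ I.Ω → J.OrdConnected → ∀ a ∈ J, ∀ b ∈ J, a ≤ b →
      ∫ x in a..b, κ x = W b - W a := fun J hJ hc a ha b hb hab =>
    hF.integral_inner_sub hG hab ((hc.out ha hb).trans hJ)
  have hWr : ∀ k, Tendsto W (𝓝[>] I.r k) (𝓝 (starRingEnd ℂ (u k) * v k)) := fun k =>
    ((Complex.continuous_conj.tendsto _).comp (hu k).1).mul (hv k).1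
  have hWs : ∀ k, Tendsto W (𝓝[<] I.s k) (𝓝 (starRingEnd ℂ (u k) * v k)) := fun k =>
    ((Complex.continuous_conj.tendsto _).comp (hu k).2).mul (hv k).2
  have key : ∫ x in I.Ω, κ x = 0 := by
    refine setIntegral_Ω_eq_zero hκ ?_ fun k hk => ?_
    · have h1 := hW _ Iio_subset_Ω ordConnected_Iio
      have h2 := hW _ Ioi_subset_Ω ordConnected_Ioi
      have hk1 := hκ.mono_set Iio_subset_Ω
      have hk2 := hκ.mono_set Ioi_subset_Ω
      have hr := hWr 0
      have hs := hWs 0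
      rw [I.r_zero] at hr
      rw [I.s_zero] at hs
      rw [setIntegral_eq_sub_of_tendsto measurableSet_Iio (l₁ := atBot) (l₂ := 𝓝[<] 0)
          (fun x hx => (eventually_le_atBot x).mono fun a ha => ⟨ha.trans_lt hx, ha⟩)
          (fun x hx => mem_of_superset (Ioo_mem_nhdsLT (mem_Iio.1 hx)) fun b hb => ⟨hb.2, hb.1.le⟩)
          ⟨-1, by simp⟩ ordConnected_Iio hk1 h1
          (tendsto_atBot_zero_of_integral_eq_sub hk1 (hWi.mono_set Iio_subset_Ω) h1) hs,
        setIntegral_eq_sub_of_tendsto measurableSet_Ioi (l₁ := 𝓝[>] 1) (l₂ := atTop)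
          (fun x hx => mem_of_superset (Ioo_mem_nhdsGT (mem_Ioi.1 hx)) fun b hb => ⟨hb.1, hb.2.le⟩)
          (fun x hx => (eventually_ge_atTop x).mono fun a ha => ⟨lt_of_lt_of_le hx ha, ha⟩)
          ⟨2, by simp⟩ ordConnected_Ioi hk2 h2 hr
          (tendsto_atTop_zero_of_integral_eq_sub hk2 (hWi.mono_set Ioi_subset_Ω) h2)]
      ring
    · rw [setIntegral_eq_sub_of_tendsto measurableSet_Ioo
          (fun x hx => mem_of_superset (Ioo_mem_nhdsGT hx.1) fun b hb =>
            ⟨⟨hb.1, hb.2.trans hx.2⟩, hb.2.le⟩)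
          (fun x hx => mem_of_superset (Ioo_mem_nhdsLT hx.2) fun b hb =>
            ⟨⟨hx.1.trans hb.1, hb.2⟩, hb.1.le⟩)
          (nonempty_Ioo.2 (I.r_lt_s k hk)) ordConnected_Ioo (hκ.mono_set (Ioo_subset_Ω hk))
          (hW _ (Ioo_subset_Ω hk) ordConnected_Ioo) (hWr k) (hWs k), sub_self]
  have h1 : ∫ x in I.Ω, κ x = 2 * Real.pi * Complex.I * (⟪f, g'⟫_ℂ - ⟪g, f'⟫_ℂ) := by
    rw [L2.inner_def, L2.inner_def, ← integral_sub (L2.integrable_inner f g')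
      (L2.integrable_inner g f'), ← integral_const_mul]
  rw [h1, mul_eq_zero, sub_eq_zero] at key
  exact (key.resolve_left (by simp [Real.pi_ne_zero])).symm

end IntervalSystem

/-! ### Square-integrable solutions of `Φ' = w Φ + ψ` -/

theorem hasDerivAt_exp_mul_add_integral {ψ : ℝ → ℂ} (hψ : Continuous ψ) (w c : ℂ) (x₀ x : ℝ) :
    HasDerivAt (fun x : ℝ => Complex.exp (w * x) *
        (c + ∫ t in x₀..x, Complex.exp (-(w * t)) * ψ t))
      (w * (Complex.exp (w * x) * (c + ∫ t in x₀..x, Complex.exp (-(w * t)) * ψ t)) + ψ x) x := by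
  have h1 : HasDerivAt (fun x : ℝ => Complex.exp (w * x)) (Complex.exp (w * x) * w) x := by
    simpa using ((Complex.ofRealCLM.hasDerivAt (x := x)).const_mul w).cexp
  have h2 : Continuous fun t : ℝ => Complex.exp (-(w * t)) * ψ t := by fun_prop
  refine (h1.mul ((h2.integral_hasStrictDerivAt x₀ x).hasDerivAt.const_add c)).congr_deriv ?_
  have h3 : Complex.exp (w * x) * (Complex.exp (-(w * x)) * ψ x) = ψ x := by
    rw [← mul_assoc, ← Complex.exp_add, add_neg_cancel, Complex.exp_zero, one_mul]
  rw [h3]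
  ring

theorem memLp_two_cexp_Ioi {w : ℂ} (hw : w.re < 0) (M : ℝ) :
    MemLp (fun x : ℝ => Complex.exp (w * x)) 2 (volume.restrict (Ioi M)) := by
  have hc : Continuous fun x : ℝ => Complex.exp (w * x) := by fun_prop
  rw [memLp_two_iff_integrable_sq_norm hc.aestronglyMeasurable]
  have h : ∀ x : ℝ, ‖Complex.exp (w * x)‖ ^ 2 = Real.exp (2 * w.re * x) := fun x => by
    rw [Complex.norm_exp, ← Real.exp_nat_mul]
    simp
    ring
  simp_rw [h]
  exact integrableOn_exp_mul_Ioi (by linarith) M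

theorem ContinuousOn.memLp_restrict_Icc {f : ℝ → ℂ} {a b : ℝ} (hf : ContinuousOn f (Icc a b)) :
    MemLp f 2 (volume.restrict (Icc a b)) := by
  obtain ⟨C, hC⟩ := isCompact_Icc.exists_bound_of_continuousOn hf
  exact MemLp.of_bound (hf.aestronglyMeasurable measurableSet_Icc) C
    ((ae_restrict_mem measurableSet_Icc).mono hC)

/-- Variation of constants started to the left of the support of `ψ`: the solution is zero before
the support and a multiple of the decaying `exp (w x)` after it. -/
theorem exists_memLp_hasDerivAt_of_re_neg {ψ : ℝ → ℂ} (hψ : Continuous ψ)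
    (hc : HasCompactSupport ψ) {w : ℂ} (hw : w.re < 0) :
    ∃ Φ : ℝ → ℂ, (∀ x, HasDerivAt Φ (w * Φ x + ψ x) x) ∧ MemLp Φ 2 := by
  obtain ⟨M, hM⟩ := hc.isCompact.isBounded.subset_closedBall 0
  rw [Real.closedBall_eq_Icc, zero_sub, zero_add] at hM
  have h0 : ∀ x, x ∉ Icc (-M) M → ψ x = 0 := fun x hx =>
    image_eq_zero_of_notMem_tsupport fun h => hx (hM h)
  have hd := hasDerivAt_exp_mul_add_integral hψ w 0 (-M)
  refine ⟨_, hd, ?_⟩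
  have hcont : Continuous fun x : ℝ => Complex.exp (w * x) *
        (0 + ∫ t in (-M)..x, Complex.exp (-(w * t)) * ψ t) :=
    continuous_iff_continuousAt.2 fun x => (hd x).continuousAt
  have h1 := ((memLp_indicator_iff_restrict measurableSet_Icc).2
    (hcont.continuousOn (s := Icc (-M) M)).memLp_restrict_Icc)
  have h2 := ((memLp_indicator_iff_restrict measurableSet_Ioi).2
    ((memLp_two_cexp_Ioi hw M).mul_const (∫ t in (-M)..M, Complex.exp (-(w * t)) * ψ t)))
  refine (h1.add h2).ae_eq (Eventually.of_forall fun x => ?_)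
  simp only [Pi.add_apply, indicator, zero_add]
  have hcψ : Continuous fun t : ℝ => Complex.exp (-(w * t)) * ψ t := by fun_prop
  rcases lt_or_ge x (-M) with hx | hx
  · have hz : ∫ t in (-M)..x, Complex.exp (-(w * t)) * ψ t = 0 := by
      rw [intervalIntegral.integral_symm, intervalIntegral.integral_zero_ae, neg_zero]
      have hae : ∀ᵐ t : ℝ, t ≠ -M := by simp [ae_iff]
      filter_upwards [hae] with t ht hmem
      rw [uIoc_of_le hx.le] at hmem
      rw [h0 t fun h => ht (le_antisymm hmem.2 h.1), mul_zero]
    rw [if_neg fun h => hx.not_ge h.1, hz, mul_zero, zero_add]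
    -- `M` may be negative, and then `x < -M` does not exclude `M < x`; in that case `ψ` vanishes
    -- identically.
    split_ifs with h
    · rw [intervalIntegral.integral_zero_ae, mul_zero]
      refine Eventually.of_forall fun t ht => ?_
      rw [h0 t, mul_zero]
      intro h'
      linarith [h'.1, h'.2, mem_Ioi.1 h]
    · rfl
  · rcases le_or_gt x M with hxM | hxM
    · rw [if_pos ⟨hx, hxM⟩, if_neg (fun h : x ∈ Ioi M => hxM.not_gt h), add_zero]
    · rw [if_neg fun h => hxM.not_ge h.2, if_pos (mem_Ioi.2 hxM), zero_add,
        ← intervalIntegral.integral_add_adjacent_intervals (b := M) (c := x)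
          (hcψ.intervalIntegrable _ _) (hcψ.intervalIntegrable _ _),
        intervalIntegral.integral_zero_ae (a := M), add_zero]
      refine Eventually.of_forall fun t ht => ?_
      rw [uIoc_of_le hxM.le] at ht
      rw [h0 t fun h => ht.1.not_ge h.2, mul_zero]

/-- The equation `Φ' = w Φ + ψ` has a square-integrable solution on the line if `w` is not purely
imaginary. -/
theorem exists_memLp_hasDerivAt {ψ : ℝ → ℂ} (hψ : Continuous ψ)
    (hc : HasCompactSupport ψ) {w : ℂ} (hw : w.re ≠ 0) :
    ∃ Φ : ℝ → ℂ, (∀ x, HasDerivAt Φ (w * Φ x + ψ x) x) ∧ MemLp Φ 2 := by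
  rcases hw.lt_or_gt with hw | hw
  · exact exists_memLp_hasDerivAt_of_re_neg hψ hc hw
  · obtain ⟨Φ, h1, h2⟩ := exists_memLp_hasDerivAt_of_re_neg (ψ := fun x => -ψ (-x)) (w := -w)
      (by fun_prop) (hc.comp_homeomorph (Homeomorph.neg ℝ)).neg (by simpa using hw)
    refine ⟨fun x => Φ (-x), fun x => ?_, h2.comp_measurePreserving (Measure.measurePreserving_neg _)⟩
    refine ((h1 (-x)).scomp x (hasDerivAt_neg x)).congr_deriv ?_
    simp

/-! ### Elements of the core supported on one circle or on the glued line -/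

namespace IntervalSystem

variable {I : IntervalSystem}

open scoped InnerProductSpace

theorem mem_graph_boundaryMomentum_one {F G : ℝ → ℂ} (hF : MemLp F 2 (volume.restrict I.Ω))
    (hG : MemLp G 2 (volume.restrict I.Ω))
    (hd : ∀ x ∈ I.Ω, HasDerivAt F (2 * Real.pi * Complex.I * G x) x) {u : BoundarySpace}
    (hu : I.HasBoundaryValues F u u) :
    (hF.toLp F, hG.toLp G) ∈ (I.boundaryMomentum 1).graph := by
  refine (mem_graph_boundaryMomentum I).2 ⟨F, u, IsRep.of_sub_eq_integral hF.coeFn_toLp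
    fun a b hab hs => ?_, hu⟩
  have hint : IntervalIntegrable (hG.toLp G) volume a b := L2.intervalIntegrable _ hs hab
  have hae : ∀ᵐ x : ℝ, x ∈ uIoc a b → hG.toLp G x = G x := by
    filter_upwards [ae_restrict_Ω_iff.1 hG.coeFn_toLp] with x hx hxab
    rw [uIoc_of_le hab] at hxab
    exact hx (hs (Ioc_subset_Icc_self hxab))
  rw [intervalIntegral.integral_congr_ae hae, ← intervalIntegral.integral_const_mul,
    intervalIntegral.integral_eq_sub_of_hasDerivAt]
  · intro x hx
    rw [uIcc_of_le hab] at hx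
    exact hd x (hs hx)
  · exact (hint.congr_ae ((ae_restrict_iff' measurableSet_uIoc).2 hae)).const_mul _

theorem eventually_notMem_of_mem_Ω {k : ℕ} (hk : 1 ≤ k) {x : ℝ} (hx : x ∈ I.Ω)
    (hxk : x ∉ Ioo (I.r k) (I.s k)) : ∀ᶠ y in 𝓝 x, y ∉ Ioo (I.r k) (I.s k) := by
  rcases hx with (hx | hx) | hx
  · filter_upwards [isOpen_Iio.mem_nhds hx] with y hy h
    exact lt_asymm hy (I.subset_unit k hk h).1
  · filter_upwards [isOpen_Ioi.mem_nhds hx] with y hy h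
    exact lt_asymm hy (I.subset_unit k hk h).2
  · obtain ⟨l, hl, hx⟩ := mem_iUnion₂.1 hx
    have hne : l ≠ k := by rintro rfl; exact hxk hx
    filter_upwards [isOpen_Ioo.mem_nhds hx] with y hy
    exact Set.disjoint_left.1 (I.disjoint l k hl hk hne) hy

/-- The point `r l` may be an endpoint of `I k` as well, so a full neighbourhood would not do; the
right-hand one lies in the component of index `l`. -/
theorem eventually_notMem_nhdsGT_r {k l : ℕ} (hk : 1 ≤ k) (hlk : l ≠ k) :
    ∀ᶠ y in 𝓝[>] I.r l, y ∉ Ioo (I.r k) (I.s k) := by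
  rcases Nat.eq_zero_or_pos l with rfl | hl
  · rw [I.r_zero]
    filter_upwards [self_mem_nhdsWithin] with y hy h
    exact lt_asymm hy (I.subset_unit k hk h).2
  · filter_upwards [Ioo_mem_nhdsGT (I.r_lt_s l hl)] with y hy
    exact Set.disjoint_left.1 (I.disjoint l k hl hk hlk) hy

theorem eventually_notMem_nhdsLT_s {k l : ℕ} (hk : 1 ≤ k) (hlk : l ≠ k) :
    ∀ᶠ y in 𝓝[<] I.s l, y ∉ Ioo (I.r k) (I.s k) := by
  rcases Nat.eq_zero_or_pos l with rfl | hl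
  · rw [I.s_zero]
    filter_upwards [self_mem_nhdsWithin] with y hy h
    exact lt_asymm hy (I.subset_unit k hk h).1
  · filter_upwards [Ioo_mem_nhdsLT (I.r_lt_s l hl)] with y hy
    exact Set.disjoint_left.1 (I.disjoint l k hl hk hlk) hy

theorem memLp_indicator_Ioo {Φ : ℝ → ℂ} (hΦ : Continuous Φ) (a b : ℝ) :
    MemLp ((Ioo a b).indicator Φ) 2 (volume.restrict I.Ω) :=
  ((memLp_indicator_iff_restrict measurableSet_Ioo).2
    (hΦ.continuousOn.memLp_restrict_Icc.mono_measure
      (Measure.restrict_mono_set _ Ioo_subset_Icc_self))).restrict _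

/-- A periodic function on one of the intervals gives an element of the domain. -/
theorem exists_mem_graph_of_interval {k : ℕ} (hk : 1 ≤ k) {Φ G : ℝ → ℂ} (hG : Continuous G)
    (hd : ∀ x, HasDerivAt Φ (2 * Real.pi * Complex.I * G x) x) (hper : Φ (I.r k) = Φ (I.s k)) :
    ∃ p ∈ (I.boundaryMomentum 1).graph,
      p.1 =ᵐ[volume.restrict I.Ω] (Ioo (I.r k) (I.s k)).indicator Φ ∧
      p.2 =ᵐ[volume.restrict I.Ω] (Ioo (I.r k) (I.s k)).indicator G := by
  have hΦ : Continuous Φ := continuous_iff_continuousAt.2 fun x => (hd x).continuousAt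
  have h1 := memLp_indicator_Ioo (I := I) hΦ (I.r k) (I.s k)
  have h2 := memLp_indicator_Ioo (I := I) hG (I.r k) (I.s k)
  refine ⟨_, mem_graph_boundaryMomentum_one h1 h2 (fun x hx => ?_)
    (u := lp.single 2 k (Φ (I.r k))) (fun l => ?_), h1.coeFn_toLp, h2.coeFn_toLp⟩
  · by_cases hxk : x ∈ Ioo (I.r k) (I.s k)
    · rw [indicator_of_mem hxk]
      refine (hd x).congr_of_eventuallyEq ?_
      filter_upwards [isOpen_Ioo.mem_nhds hxk] with y hy
      rw [indicator_of_mem hy]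
    · rw [indicator_of_notMem hxk, mul_zero]
      refine (hasDerivAt_const x (0 : ℂ)).congr_of_eventuallyEq ?_
      filter_upwards [eventually_notMem_of_mem_Ω hk hx hxk] with y hy
      rw [indicator_of_notMem hy]
  · by_cases hlk : l = k
    · subst hlk
      rw [lp.single_apply_self]
      constructor
      · refine (hΦ.continuousWithinAt.tendsto).congr' ?_
        filter_upwards [Ioo_mem_nhdsGT (I.r_lt_s l hk)] with y hy
        rw [indicator_of_mem hy]
      · rw [hper]
        refine (hΦ.continuousWithinAt.tendsto).congr' ?_
        filter_upwards [Ioo_mem_nhdsLT (I.r_lt_s l hk)] with y hy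
        rw [indicator_of_mem hy]
    · rw [lp.single_apply_ne _ _ _ hlk]
      constructor
      · refine tendsto_const_nhds.congr' ?_
        filter_upwards [eventually_notMem_nhdsGT_r hk hlk] with y hy
        rw [indicator_of_notMem hy]
      · refine tendsto_const_nhds.congr' ?_
        filter_upwards [eventually_notMem_nhdsLT_s hk hlk] with y hy
        rw [indicator_of_notMem hy]

/-- The function on the two half-lines obtained from a function on the line by cutting at `0` and
inserting the gap `[0, 1]`. -/
noncomputable def cutLine (Φ : ℝ → ℂ) : ℝ → ℂ :=
  (Iio 0).indicator Φ + (Ioi 1).indicator fun x => Φ (x - 1)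

theorem cutLine_of_neg (Φ : ℝ → ℂ) {x : ℝ} (hx : x < 0) : cutLine Φ x = Φ x := by
  have h1 : x ∉ Ioi (1 : ℝ) := fun h => by linarith [mem_Ioi.1 h]
  simp [cutLine, indicator_of_mem (mem_Iio.2 hx), indicator_of_notMem h1]

theorem cutLine_of_one_lt (Φ : ℝ → ℂ) {x : ℝ} (hx : 1 < x) : cutLine Φ x = Φ (x - 1) := by
  have h1 : x ∉ Iio (0 : ℝ) := fun h => by linarith [mem_Iio.1 h]
  simp [cutLine, indicator_of_mem (mem_Ioi.2 hx), indicator_of_notMem h1]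

theorem cutLine_of_mem (Φ : ℝ → ℂ) {x : ℝ} (hx : x ∈ Ioo (0 : ℝ) 1) : cutLine Φ x = 0 := by
  have h1 : x ∉ Iio (0 : ℝ) := fun h => lt_asymm hx.1 h
  have h2 : x ∉ Ioi (1 : ℝ) := fun h => lt_asymm hx.2 h
  simp [cutLine, indicator_of_notMem h1, indicator_of_notMem h2]

theorem memLp_cutLine {Φ : ℝ → ℂ} (hΦ : MemLp Φ 2) :
    MemLp (cutLine Φ) 2 (volume.restrict I.Ω) :=
  ((hΦ.indicator measurableSet_Iio).add
    ((hΦ.comp_measurePreserving (measurePreserving_sub_right volume 1)).indicator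
      measurableSet_Ioi)).restrict _

/-- Both boundary values of index `0` are `Φ 0`, because `Φ` is continuous where the line is cut. -/
theorem exists_mem_graph_of_line {Φ G : ℝ → ℂ} (hΦ2 : MemLp Φ 2) (hG2 : MemLp G 2)
    (hd : ∀ x, HasDerivAt Φ (2 * Real.pi * Complex.I * G x) x) :
    ∃ p ∈ (I.boundaryMomentum 1).graph,
      p.1 =ᵐ[volume.restrict I.Ω] cutLine Φ ∧ p.2 =ᵐ[volume.restrict I.Ω] cutLine G := by
  have hΦ : Continuous Φ := continuous_iff_continuousAt.2 fun x => (hd x).continuousAt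
  have h1 := memLp_cutLine (I := I) hΦ2
  have h2 := memLp_cutLine (I := I) hG2
  refine ⟨_, mem_graph_boundaryMomentum_one h1 h2 (fun x hx => ?_)
    (u := lp.single 2 0 (Φ 0)) (fun l => ?_), h1.coeFn_toLp, h2.coeFn_toLp⟩
  · rcases hx with (hx | hx) | hx
    · rw [cutLine_of_neg _ hx]
      refine (hd x).congr_of_eventuallyEq ?_
      filter_upwards [isOpen_Iio.mem_nhds hx] with y hy
      rw [cutLine_of_neg _ hy]
    · rw [cutLine_of_one_lt _ hx]
      refine ((hd (x - 1)).comp_sub_const x 1).congr_of_eventuallyEq ?_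
      filter_upwards [isOpen_Ioi.mem_nhds hx] with y hy
      rw [cutLine_of_one_lt _ hy]
    · obtain ⟨l, hl, hx⟩ := mem_iUnion₂.1 hx
      have hx' := I.subset_unit l hl hx
      rw [cutLine_of_mem _ hx', mul_zero]
      refine (hasDerivAt_const x (0 : ℂ)).congr_of_eventuallyEq ?_
      filter_upwards [isOpen_Ioo.mem_nhds hx'] with y hy
      rw [cutLine_of_mem _ hy]
  · rcases Nat.eq_zero_or_pos l with rfl | hl
    · rw [lp.single_apply_self, I.r_zero, I.s_zero]
      constructor
      · have h : Tendsto (fun x : ℝ => Φ (x - 1)) (𝓝[>] 1) (𝓝 (Φ 0)) := by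
          have : Continuous fun x : ℝ => Φ (x - 1) := by fun_prop
          simpa using (this.continuousWithinAt (s := Ioi 1) (x := 1)).tendsto
        refine h.congr' ?_
        filter_upwards [self_mem_nhdsWithin] with y hy
        rw [cutLine_of_one_lt _ hy]
      · refine (hΦ.continuousWithinAt.tendsto).congr' ?_
        filter_upwards [self_mem_nhdsWithin] with y hy
        rw [cutLine_of_neg _ hy]
    · rw [lp.single_apply_ne _ _ _ hl.ne']
      constructor
      · refine tendsto_const_nhds.congr' ?_
        filter_upwards [Ioo_mem_nhdsGT (I.r_lt_s l hl)] with y hy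
        rw [cutLine_of_mem _ (I.subset_unit l hl hy)]
      · refine tendsto_const_nhds.congr' ?_
        filter_upwards [Ioo_mem_nhdsLT (I.r_lt_s l hl)] with y hy
        rw [cutLine_of_mem _ (I.subset_unit l hl hy)]

/-! ### Triviality of the orthogonal complement of the range -/

theorem ae_eq_zero_of_forall_integral {h : I.L2} {U : Set ℝ} (hU : IsOpen U) (hUΩ : U ⊆ I.Ω)
    (H : ∀ ψ : ℝ → ℝ, Continuous ψ → HasCompactSupport ψ → tsupport ψ ⊆ U →
      ∃ y : I.L2, ⟪y, h⟫_ℂ = 0 ∧ y =ᵐ[volume.restrict I.Ω] fun x => (ψ x : ℂ)) :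
    ∀ᵐ x : ℝ, x ∈ U → h x = 0 := by
  have hloc : LocallyIntegrableOn h U :=
    locallyIntegrableOn_of_locallyIntegrable_restrict
      ((L2.memLp h hUΩ).locallyIntegrable one_le_two)
  refine hU.ae_eq_zero_of_integral_contDiff_smul_eq_zero hloc fun ψ h1 h2 h3 => ?_
  obtain ⟨y, hy1, hy2⟩ := H ψ h1.continuous h2 h3
  rw [L2.inner_def] at hy1
  rw [← setIntegral_eq_integral_of_forall_compl_eq_zero (s := I.Ω), ← hy1]
  · refine integral_congr_ae ?_
    filter_upwards [hy2] with x hx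
    rw [hx, RCLike.inner_apply, Complex.conj_ofReal, Complex.real_smul, mul_comm]
  · intro x hx
    rw [image_eq_zero_of_notMem_tsupport fun h => hx (hUΩ (h3 h)), zero_smul]

/-- For non-real `z` the number `w = 2πi z` has nonzero real part. Then `Φ' = w Φ + 2πi ψ` has a
square-integrable solution on the line and a periodic one on each interval. So every test function
supported in one component is in the range, and `h` vanishes on that component. -/
theorem orthogonal_range_boundaryMomentum {z : ℂ} (hz : z.im ≠ 0) {h : I.L2}
    (hh : ∀ x : (I.boundaryMomentum 1).domain, ⟪I.boundaryMomentum 1 x - z • x.1, h⟫_ℂ = 0) :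
    h = 0 := by
  have hh' : ∀ p ∈ (I.boundaryMomentum 1).graph, ⟪p.2 - z • p.1, h⟫_ℂ = 0 := by
    rintro ⟨a, b⟩ hp
    obtain ⟨x, rfl, rfl⟩ := (LinearPMap.mem_graph_iff _).1 hp
    exact hh x
  set w : ℂ := 2 * Real.pi * Complex.I * z with hw
  have hwre : w.re ≠ 0 := by
    have : w.re = -(2 * Real.pi * z.im) := by simp [hw]
    rw [this, neg_ne_zero]
    exact mul_ne_zero (mul_ne_zero two_ne_zero Real.pi_ne_zero) hz
  have hd : ∀ {Φ : ℝ → ℂ} {ψ : ℝ → ℂ},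
      (∀ x, HasDerivAt Φ (w * Φ x + 2 * Real.pi * Complex.I * ψ x) x) →
      ∀ x, HasDerivAt Φ (2 * Real.pi * Complex.I * (z * Φ x + ψ x)) x := fun hΦ x =>
    (hΦ x).congr_deriv (by rw [hw]; ring)
  have hline : ∀ ψ : ℝ → ℝ, Continuous ψ → HasCompactSupport ψ →
      ∃ y : I.L2, ⟪y, h⟫_ℂ = 0 ∧ y =ᵐ[volume.restrict I.Ω] cutLine fun x => (ψ x : ℂ) := by
    intro ψ h1 h2
    have hc : HasCompactSupport fun x => (ψ x : ℂ) := h2.comp_left (g := Complex.ofReal) rfl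
    have hcont : Continuous fun x => (ψ x : ℂ) := by fun_prop
    obtain ⟨Φ, hΦ, hΦ2⟩ := exists_memLp_hasDerivAt
      (ψ := fun x => 2 * Real.pi * Complex.I * ψ x) (by fun_prop) hc.mul_left hwre
    have hG2 : MemLp (fun x => z * Φ x + ψ x) 2 :=
      (hΦ2.const_mul z).add (hcont.memLp_of_hasCompactSupport hc)
    obtain ⟨p, hp, hp1, hp2⟩ := exists_mem_graph_of_line (I := I) hΦ2 hG2 (hd hΦ)
    refine ⟨_, hh' p hp, ?_⟩
    filter_upwards [hp1, hp2, Lp.coeFn_sub p.2 (z • p.1), Lp.coeFn_smul z p.1] with x h1 h2 h3 h4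
    rw [h3, Pi.sub_apply, h4, Pi.smul_apply, h1, h2]
    simp only [cutLine, Pi.add_apply, indicator, smul_eq_mul]
    split_ifs <;> ring
  have hneg : ∀ᵐ x : ℝ, x ∈ Iio 0 → h x = 0 := by
    refine ae_eq_zero_of_forall_integral isOpen_Iio Iio_subset_Ω fun ψ h1 h2 h3 => ?_
    obtain ⟨y, hy1, hy2⟩ := hline ψ h1 h2
    refine ⟨y, hy1, hy2.trans ?_⟩
    have h0 : ∀ x, 0 ≤ x → ψ x = 0 := fun x hx =>
      image_eq_zero_of_notMem_tsupport fun h => (h3 h).not_ge hx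
    filter_upwards [ae_restrict_mem isOpen_Ω.measurableSet] with x hx
    rcases hx with (hx | hx) | hx
    · rw [cutLine_of_neg _ hx]
    · rw [cutLine_of_one_lt _ hx, h0 _ (by linarith [mem_Ioi.1 hx]),
        h0 _ (by linarith [mem_Ioi.1 hx])]
    · obtain ⟨l, hl, hx⟩ := mem_iUnion₂.1 hx
      have hx' := I.subset_unit l hl hx
      rw [cutLine_of_mem _ hx', h0 _ hx'.1.le, Complex.ofReal_zero]
  have hpos : ∀ᵐ x : ℝ, x ∈ Ioi 1 → h x = 0 := by
    refine ae_eq_zero_of_forall_integral isOpen_Ioi Ioi_subset_Ω fun ψ h1 h2 h3 => ?_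
    -- The shift by `1` places a test function on `(1, ∞)` on the positive half of the glued line.
    obtain ⟨y, hy1, hy2⟩ := hline (fun x => ψ (x + 1)) (by fun_prop)
      (h2.comp_homeomorph (Homeomorph.addRight 1))
    refine ⟨y, hy1, hy2.trans ?_⟩
    have h0 : ∀ x, x ≤ 1 → ψ x = 0 := fun x hx =>
      image_eq_zero_of_notMem_tsupport fun h => (h3 h).not_ge hx
    filter_upwards [ae_restrict_mem isOpen_Ω.measurableSet] with x hx
    rcases hx with (hx | hx) | hx
    · rw [cutLine_of_neg _ hx, h0 _ (by linarith [mem_Iio.1 hx]),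
        h0 _ (by linarith [mem_Iio.1 hx])]
    · rw [cutLine_of_one_lt _ hx, sub_add_cancel]
    · obtain ⟨l, hl, hx⟩ := mem_iUnion₂.1 hx
      have hx' := I.subset_unit l hl hx
      rw [cutLine_of_mem _ hx', h0 _ hx'.2.le, Complex.ofReal_zero]
  have hint : ∀ k, 1 ≤ k → ∀ᵐ x : ℝ, x ∈ Ioo (I.r k) (I.s k) → h x = 0 := by
    intro k hk
    refine ae_eq_zero_of_forall_integral isOpen_Ioo (Ioo_subset_Ω hk) fun ψ h1 h2 h3 => ?_
    have hcont : Continuous fun x => 2 * Real.pi * Complex.I * (ψ x : ℂ) := by fun_prop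
    have hne : Complex.exp (w * I.r k) - Complex.exp (w * I.s k) ≠ 0 := by
      intro h0
      have h4 := congrArg norm (sub_eq_zero.1 h0)
      rw [Complex.norm_exp, Complex.norm_exp, Real.exp_eq_exp] at h4
      simp only [Complex.re_mul_ofReal] at h4
      exact (I.r_lt_s k hk).ne (mul_left_cancel₀ hwre h4)
    set J := ∫ t in (I.r k)..(I.s k), Complex.exp (-(w * t)) * (2 * Real.pi * Complex.I * ψ t)
    -- The initial constant `c` is the solution of the periodicity condition `exp (w r) c = exp (w
    -- s) (c + J)`.
    have hΦ := hasDerivAt_exp_mul_add_integral hcont w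
      (Complex.exp (w * I.s k) * J / (Complex.exp (w * I.r k) - Complex.exp (w * I.s k))) (I.r k)
    set Φ : ℝ → ℂ := fun x => Complex.exp (w * x) *
      (Complex.exp (w * I.s k) * J / (Complex.exp (w * I.r k) - Complex.exp (w * I.s k)) +
        ∫ t in (I.r k)..x, Complex.exp (-(w * t)) * (2 * Real.pi * Complex.I * ψ t)) with hΦdef
    have hper : Φ (I.r k) = Φ (I.s k) := by
      have hr : Φ (I.r k) = Complex.exp (w * I.r k) * (Complex.exp (w * I.s k) * J /
          (Complex.exp (w * I.r k) - Complex.exp (w * I.s k))) := by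
        simp [hΦdef]
      have hs : Φ (I.s k) = Complex.exp (w * I.s k) * (Complex.exp (w * I.s k) * J /
          (Complex.exp (w * I.r k) - Complex.exp (w * I.s k)) + J) := rfl
      rw [hr, hs]
      field_simp
      ring
    have hΦc : Continuous Φ := continuous_iff_continuousAt.2 fun x => (hΦ x).continuousAt
    obtain ⟨p, hp, hp1, hp2⟩ := exists_mem_graph_of_interval hk
      (G := fun x => z * Φ x + ψ x) (by fun_prop) (hd hΦ) hper
    refine ⟨_, hh' p hp, ?_⟩
    filter_upwards [hp1, hp2, Lp.coeFn_sub p.2 (z • p.1), Lp.coeFn_smul z p.1] with x h4 h5 h6 h7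
    rw [h6, Pi.sub_apply, h7, Pi.smul_apply, h4, h5]
    by_cases hx : x ∈ Ioo (I.r k) (I.s k)
    · simp only [indicator_of_mem hx, smul_eq_mul]
      ring
    · rw [indicator_of_notMem hx, indicator_of_notMem hx,
        image_eq_zero_of_notMem_tsupport fun h => hx (h3 h)]
      simp
  rw [Lp.eq_zero_iff_ae_eq_zero, EventuallyEq, ae_restrict_Ω_iff]
  filter_upwards [hneg, hpos, ae_all_iff.2 fun k => ae_all_iff.2 (hint k)] with x h1 h2 h3 hx
  rcases hx with (hx | hx) | hx
  · exact h1 hx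
  · exact h2 hx
  · obtain ⟨l, hl, hx⟩ := mem_iUnion₂.1 hx
    exact h3 l hl hx

theorem momentum_one_isEssentiallySurjective :
    UnboundedOperator.IsEssentiallySurjective (I.momentum 1) :=
  UnboundedOperator.isEssentiallySurjective_closure (boundaryMomentum_isClosable 1)
    boundaryMomentum_one_isFormalAdjoint fun _ hz _ hh => orthogonal_range_boundaryMomentum hz hh

end IntervalSystem

/-! ### Eigenvectors and multiplicities -/

namespace IntervalSystem

variable {I : IntervalSystem}

open scoped InnerProductSpace

theorem len_pos {k : ℕ} (hk : 1 ≤ k) : 0 < I.len k := sub_pos.2 (I.r_lt_s k hk)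

/-- The exponential `x ↦ exp (2πi t x)`. -/
noncomputable def wave (t x : ℝ) : ℂ := Complex.exp (2 * Real.pi * Complex.I * t * x)

theorem norm_wave (t x : ℝ) : ‖wave t x‖ = 1 := by
  have h : 2 * Real.pi * Complex.I * t * x = ((2 * Real.pi * t * x : ℝ) : ℂ) * Complex.I := by
    push_cast; ring
  rw [wave, h, Complex.norm_exp_ofReal_mul_I]

theorem contDiff_wave (t : ℝ) : ContDiff ℝ 1 (wave t) := by
  unfold wave
  have : ContDiff ℝ 1 fun x : ℝ => (x : ℂ) := Complex.ofRealCLM.contDiff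
  fun_prop

theorem continuous_wave (t : ℝ) : Continuous (wave t) := (contDiff_wave t).continuous

theorem hasDerivAt_wave (t x : ℝ) :
    HasDerivAt (wave t) (2 * Real.pi * Complex.I * (t * wave t x)) x := by
  have h := ((Complex.ofRealCLM.hasDerivAt (x := x)).const_mul
    (2 * Real.pi * Complex.I * t)).cexp
  refine h.congr_deriv ?_
  simp [wave]
  ring

theorem wave_neg_mul (t x : ℝ) : wave (-t) x * wave t x = 1 := by
  rw [wave, wave, ← Complex.exp_add, Complex.exp_eq_one_iff]
  exact ⟨0, by push_cast; ring⟩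

/-- Integrating factor: `wave (-t) * F - Y` is absolutely continuous with derivative zero almost
everywhere. The case `y = 0` describes eigenfunctions, and `y = wave t x / x` excludes solutions for
`resonance`. -/
theorem IsRep.eq_wave_mul {f g : I.L2} {F : ℝ → ℂ} (h : I.IsRep f g F) {J : Set ℝ}
    (hJ : J.OrdConnected) (hJΩ : J ⊆ I.Ω) {t : ℝ} {y Y : ℝ → ℂ}
    (hg : ∀ᵐ x : ℝ, x ∈ J → g x = t * f x + y x) (hYc : ContDiffOn ℝ 1 Y J)
    (hY : ∀ x ∈ J, HasDerivAt Y (2 * Real.pi * Complex.I * (wave (-t) x * y x)) x) :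
    ∃ c : ℂ, ∀ x ∈ J, F x = wave t x * (c + Y x) := by
  have hconst : ∀ a ∈ J, ∀ b ∈ J, a ≤ b →
      wave (-t) a * F a - Y a = wave (-t) b * F b - Y b := by
    intro a ha b hb hab
    have hs : Icc a b ⊆ J := hJ.out ha hb
    have hF := h.absCont a b hab (hs.trans hJΩ)
    have hw : AbsolutelyContinuousOnInterval (wave (-t)) a b :=
      (contDiff_wave _).contDiffOn.absolutelyContinuousOnInterval
    have hYac : AbsolutelyContinuousOnInterval Y a b := by
      rw [← uIcc_of_le hab] at hs
      exact (hYc.mono hs).absolutelyContinuousOnInterval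
    have hac := (hw.fun_smul hF).fun_sub hYac
    simp only [smul_eq_mul] at hac
    obtain ⟨C, hC⟩ := hac.const_of_ae_hasDerivAt_zero (by
      filter_upwards [hg, ae_restrict_Ω_iff.1 h.hasDeriv, ae_restrict_Ω_iff.1 h.ae_eq]
        with x h1 h2 h3 hx
      rw [uIcc_of_le hab] at hx
      have hxJ := hs hx
      refine (((hasDerivAt_wave (-t) x).fun_mul (h2 (hJΩ hxJ))).fun_sub (hY x hxJ)).congr_deriv ?_
      rw [h1 hxJ, h3 (hJΩ hxJ)]
      push_cast
      ring)
    rw [hC a left_mem_uIcc, hC b right_mem_uIcc]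
  have hF : ∀ x c, wave (-t) x * F x - Y x = c → F x = wave t x * (c + Y x) := by
    rintro x c rfl
    linear_combination -F x * wave_neg_mul t x
  rcases J.eq_empty_or_nonempty with rfl | ⟨a, ha⟩
  · exact ⟨0, fun x hx => absurd hx (notMem_empty x)⟩
  · refine ⟨_, fun x hx => hF x (wave (-t) a * F a - Y a) ?_⟩
    rcases le_total a x with hax | hax
    · exact (hconst a ha x hx hax).symm
    · exact hconst x hx a ha hax

theorem not_forall_le_norm {f : I.L2} {F : ℝ → ℂ} (hf : f =ᵐ[volume.restrict I.Ω] F) {S : Set ℝ}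
    (hS : MeasurableSet S) (hSΩ : S ⊆ I.Ω) (hvol : volume S = ⊤) {δ : ℝ} (hδ : 0 < δ) :
    ¬ ∀ x ∈ S, δ ≤ ‖F x‖ := by
  intro h
  have hF : MemLp F 2 (volume.restrict S) :=
    (L2.memLp f hSΩ).ae_eq (ae_restrict_of_ae_restrict_of_subset hSΩ hf)
  have h1 : MemLp (fun _ : ℝ => δ) 2 (volume.restrict S) :=
    hF.mono aestronglyMeasurable_const ((ae_restrict_mem hS).mono fun x hx => by
      rw [Real.norm_of_nonneg hδ.le]; exact h x hx)
  rw [memLp_const_iff (by norm_num) (by norm_num), Measure.restrict_apply_univ, hvol] at h1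
  exact h1.elim hδ.ne' (lt_irrefl _)

theorem L2.coeFn_smul {f : I.L2} {z : ℂ} :
    (z • f : I.L2) =ᵐ[volume.restrict I.Ω] fun x => z * f x := by
  filter_upwards [Lp.coeFn_smul z f] with x hx
  rw [hx, Pi.smul_apply, smul_eq_mul]

theorem exists_isRep_of_mem_graph {f g : I.L2} (h : (f, g) ∈ (I.momentum 1).graph) :
    ∃ F, I.IsRep f g F :=
  (mem_graph_maximalMomentum I).1 (LinearPMap.le_graph_of_le (momentum_le 1) h)

theorem mem_graph_momentum_of_mem {p : I.L2 × I.L2} (h : p ∈ (I.boundaryMomentum 1).graph) :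
    p ∈ (I.momentum 1).graph :=
  LinearPMap.le_graph_of_le (LinearPMap.le_closure _) h

variable (I)

/-- The function `exp (2πi t x)` on the `k`-th interval, extended by zero. -/
noncomputable def intervalWave (k : ℕ) (t : ℝ) : I.L2 :=
  (memLp_indicator_Ioo (I := I) (continuous_wave t) (I.r k) (I.s k)).toLp _

variable {I}

theorem intervalWave_ae_eq (k : ℕ) (t : ℝ) :
    I.intervalWave k t =ᵐ[volume.restrict I.Ω] (Ioo (I.r k) (I.s k)).indicator (wave t) :=
  MemLp.coeFn_toLp _

theorem inner_intervalWave {k : ℕ} (hk : 1 ≤ k) (t : ℝ) (f : I.L2) :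
    ⟪I.intervalWave k t, f⟫_ℂ
      = ∫ x in Ioo (I.r k) (I.s k), f x * starRingEnd ℂ (wave t x) := by
  rw [L2.inner_def, ← restrict_restrict_Ω (Ioo_subset_Ω hk) measurableSet_Ioo,
    ← integral_indicator measurableSet_Ioo]
  refine integral_congr_ae ?_
  filter_upwards [intervalWave_ae_eq k t] with x hx
  rw [hx, RCLike.inner_apply]
  by_cases h : x ∈ Ioo (I.r k) (I.s k)
  · simp only [indicator_of_mem h]
  · simp only [indicator_of_notMem h, map_zero, mul_zero]

theorem inner_intervalWave_of_eq {k : ℕ} (hk : 1 ≤ k) {t : ℝ} {f : I.L2} {c : ℂ}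
    (hf : ∀ᵐ x : ℝ, x ∈ Ioo (I.r k) (I.s k) → f x = c * wave t x) :
    ⟪I.intervalWave k t, f⟫_ℂ = c * I.len k := by
  have h : ∫ x in Ioo (I.r k) (I.s k), f x * starRingEnd ℂ (wave t x)
      = ∫ x in Ioo (I.r k) (I.s k), c := by
    refine setIntegral_congr_ae measurableSet_Ioo ?_
    filter_upwards [hf] with x hx hxk
    rw [hx hxk, mul_assoc, Complex.mul_conj, Complex.normSq_eq_norm_sq, norm_wave]
    simp
  rw [inner_intervalWave hk, h, setIntegral_const, Real.volume_real_Ioo_of_le (I.r_lt_s k hk).le,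
    Complex.real_smul, mul_comm, len]

theorem intervalWave_eq_on {k : ℕ} (hk : 1 ≤ k) (t : ℝ) :
    ∀ᵐ x : ℝ, x ∈ Ioo (I.r k) (I.s k) → I.intervalWave k t x = 1 * wave t x := by
  filter_upwards [ae_restrict_Ω_iff.1 (intervalWave_ae_eq (I := I) k t)] with x hx hxk
  rw [hx (Ioo_subset_Ω hk hxk), indicator_of_mem hxk, one_mul]

theorem intervalWave_ne_zero {k : ℕ} (hk : 1 ≤ k) (t : ℝ) : I.intervalWave k t ≠ 0 := by
  intro h
  have h1 := inner_intervalWave_of_eq hk (intervalWave_eq_on (I := I) hk t)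
  rw [one_mul, h, inner_zero_right] at h1
  exact (len_pos hk).ne' (Complex.ofReal_eq_zero.1 h1.symm)

theorem inner_intervalWave_of_ne {k l : ℕ} (hk : 1 ≤ k) (hl : 1 ≤ l) (hkl : k ≠ l) (t : ℝ) :
    ⟪I.intervalWave k t, I.intervalWave l t⟫_ℂ = 0 := by
  rw [inner_intervalWave_of_eq hk (c := 0), zero_mul]
  filter_upwards [ae_restrict_Ω_iff.1 (intervalWave_ae_eq (I := I) l t)] with x hx hxk
  rw [hx (Ioo_subset_Ω hk hxk),
    indicator_of_notMem (Set.disjoint_left.1 (I.disjoint k l hk hl hkl) hxk), zero_mul]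

theorem wave_endpoints {k : ℕ} {t : ℝ} :
    wave t (I.r k) = wave t (I.s k) ↔ ∃ m : ℤ, t * I.len k = m := by
  have hC : (2 * Real.pi * Complex.I : ℂ) ≠ 0 := by simp [Real.pi_ne_zero]
  rw [eq_comm, wave, wave, Complex.exp_eq_exp_iff_exists_int]
  refine exists_congr fun m => ⟨fun h => ?_, fun h => ?_⟩
  · have h1 : ((t * I.len k : ℝ) : ℂ) = ((m : ℝ) : ℂ) := by
      apply mul_left_cancel₀ hC
      rw [len]
      push_cast
      linear_combination h
    exact Complex.ofReal_injective h1
  · have h1 : ((t * I.len k : ℝ) : ℂ) = ((m : ℝ) : ℂ) := by rw [h]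
    rw [len] at h1
    push_cast at h1
    linear_combination (2 * Real.pi * Complex.I : ℂ) * h1

theorem intervalWave_mem_eigenspace {k : ℕ} (hk : 1 ≤ k) {t : ℝ}
    (ht : ∃ m : ℤ, t * I.len k = m) :
    I.intervalWave k t ∈ UnboundedOperator.eigenspace (I.momentum 1) t := by
  obtain ⟨⟨f, g⟩, hp, h1, h2⟩ := exists_mem_graph_of_interval hk (G := fun x => t * wave t x)
    (continuous_const.mul (continuous_wave t)) (hasDerivAt_wave t) (wave_endpoints.2 ht)
  have hf : f = I.intervalWave k t := Lp.ext (h1.trans (intervalWave_ae_eq k t).symm)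
  have hg : g = (t : ℂ) • I.intervalWave k t := by
    refine Lp.ext (h2.trans ?_)
    filter_upwards [intervalWave_ae_eq (I := I) k t, Lp.coeFn_smul (t : ℂ) (I.intervalWave k t)]
      with x h3 h4
    rw [h4, Pi.smul_apply, h3]
    by_cases h : x ∈ Ioo (I.r k) (I.s k)
    · simp only [indicator_of_mem h, smul_eq_mul]
    · simp only [indicator_of_notMem h, smul_zero]
  subst hf hg
  exact mem_graph_momentum_of_mem hp

theorem exists_eq_wave_of_mem_eigenspace {t : ℝ} {f : I.L2}
    (hf : f ∈ UnboundedOperator.eigenspace (I.momentum 1) t) {J : Set ℝ} (hJ : J.OrdConnected)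
    (hJm : MeasurableSet J) (hJΩ : J ⊆ I.Ω) :
    ∃ c : ℂ, (∀ᵐ x : ℝ, x ∈ J → f x = c * wave t x) ∧ (volume J = ⊤ → c = 0) := by
  obtain ⟨F, hF⟩ := exists_isRep_of_mem_graph (show (f, (t : ℂ) • f) ∈ _ from hf)
  obtain ⟨c, hc⟩ := hF.eq_wave_mul hJ hJΩ (y := 0) (Y := 0) (by
    filter_upwards [ae_restrict_Ω_iff.1 (L2.coeFn_smul (f := f) (z := t))]
      with x hx hxJ
    rw [hx (hJΩ hxJ), Pi.zero_apply, add_zero]) contDiffOn_const fun x _ => by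
      simp
  simp only [Pi.zero_apply, add_zero] at hc
  refine ⟨c, ?_, fun hvol => ?_⟩
  · filter_upwards [ae_restrict_Ω_iff.1 hF.ae_eq] with x hx hxJ
    rw [hx (hJΩ hxJ), hc x hxJ, mul_comm]
  · by_contra h0
    refine not_forall_le_norm hF.ae_eq hJm hJΩ hvol (norm_pos_iff.2 h0) fun x hx => ?_
    rw [hc x hx, norm_mul, norm_wave, one_mul]

theorem ae_eq_zero_of_mem_eigenspace {t : ℝ} {f : I.L2}
    (hf : f ∈ UnboundedOperator.eigenspace (I.momentum 1) t) :
    ∀ᵐ x : ℝ, x ∈ Iio 0 ∪ Ioi 1 → f x = 0 := by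
  obtain ⟨c, h1, h2⟩ := exists_eq_wave_of_mem_eigenspace hf ordConnected_Iio measurableSet_Iio
    Iio_subset_Ω
  obtain ⟨d, h3, h4⟩ := exists_eq_wave_of_mem_eigenspace hf ordConnected_Ioi measurableSet_Ioi
    Ioi_subset_Ω
  filter_upwards [h1, h3] with x h5 h6 hx
  rcases hx with hx | hx
  · rw [h5 hx, h2 Real.volume_Iio, zero_mul]
  · rw [h6 hx, h4 Real.volume_Ioi, zero_mul]

/-- Symmetry against the indicator of `I k`, an eigenvector for `0`, gives `t * ∫ f = 0` over `I k`.
For `t ≠ 0` the exponential has integral zero there, so its endpoint values agree. No boundary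
values of `f` are needed. -/
theorem exists_int_of_mem_eigenspace {t : ℝ} {f : I.L2}
    (hf : f ∈ UnboundedOperator.eigenspace (I.momentum 1) t) {k : ℕ} (hk : 1 ≤ k) {c : ℂ}
    (hc : ∀ᵐ x : ℝ, x ∈ Ioo (I.r k) (I.s k) → f x = c * wave t x) (hc0 : c ≠ 0) :
    ∃ m : ℤ, t * I.len k = m := by
  by_cases ht : t = 0
  · exact ⟨0, by simp [ht]⟩
  have he : I.intervalWave k 0 ∈ UnboundedOperator.eigenspace (I.momentum 1) (0 : ℝ) :=
    intervalWave_mem_eigenspace hk ⟨0, by simp⟩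
  obtain ⟨p, hp1, hp2⟩ := UnboundedOperator.mem_eigenspace.1 hf
  obtain ⟨q, hq1, hq2⟩ := UnboundedOperator.mem_eigenspace.1 he
  have h1 := momentum_one_isEssentiallySurjective.symmetric q p
  rw [hp1, hp2, hq1, hq2, Complex.ofReal_zero, zero_smul, inner_zero_left, inner_smul_right,
    eq_comm, mul_eq_zero, or_iff_right (Complex.ofReal_ne_zero.2 ht), inner_intervalWave hk] at h1
  have h2 : ∫ x in Ioo (I.r k) (I.s k), f x * starRingEnd ℂ (wave 0 x)
      = c * ∫ x in (I.r k)..(I.s k), Complex.exp (2 * Real.pi * Complex.I * t * x) := by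
    rw [intervalIntegral.integral_of_le (I.r_lt_s k hk).le, integral_Ioc_eq_integral_Ioo,
      ← integral_const_mul]
    refine setIntegral_congr_ae measurableSet_Ioo ?_
    filter_upwards [hc] with x hx hxk
    rw [hx hxk]
    simp [wave]
  have hne : (2 * Real.pi * Complex.I * t : ℂ) ≠ 0 := by simp [Real.pi_ne_zero, ht]
  rw [h2, mul_eq_zero, or_iff_right hc0, integral_exp_mul_complex hne, div_eq_zero_iff,
    or_iff_left hne, sub_eq_zero] at h1
  exact wave_endpoints.1 h1.symm

/-- On `I k` an eigenvector is `c * wave t`, with `c = 0` unless `t ℓ_k ∈ ℤ`, and then the inner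
product is `c ℓ_k`. Thus the coefficients against the interval waves determine it. -/
theorem eq_zero_of_mem_eigenspace {t : ℝ} {f : I.L2}
    (hf : f ∈ UnboundedOperator.eigenspace (I.momentum 1) t)
    (h0 : ∀ k, 1 ≤ k → (∃ m : ℤ, t * I.len k = m) → ⟪I.intervalWave k t, f⟫_ℂ = 0) : f = 0 := by
  have hk : ∀ k, 1 ≤ k → ∀ᵐ x : ℝ, x ∈ Ioo (I.r k) (I.s k) → f x = 0 := by
    intro k hk
    obtain ⟨c, hc, -⟩ := exists_eq_wave_of_mem_eigenspace hf ordConnected_Ioo measurableSet_Ioo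
      (Ioo_subset_Ω hk)
    have hc0 : c = 0 := by
      by_contra hc0
      have h1 := h0 k hk (exists_int_of_mem_eigenspace hf hk hc hc0)
      rw [inner_intervalWave_of_eq hk hc, mul_eq_zero, Complex.ofReal_eq_zero] at h1
      exact h1.elim hc0 (len_pos hk).ne'
    filter_upwards [hc] with x hx hxk
    rw [hx hxk, hc0, zero_mul]
  rw [Lp.eq_zero_iff_ae_eq_zero, EventuallyEq, ae_restrict_Ω_iff]
  filter_upwards [ae_eq_zero_of_mem_eigenspace hf, ae_all_iff.2 fun k => ae_all_iff.2 (hk k)]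
    with x h1 h2 hx
  rcases hx with hx | hx
  · exact h1 hx
  · obtain ⟨l, hl, hx⟩ := mem_iUnion₂.1 hx
    exact h2 l hl hx

theorem eigenspace_ne_bot_iff {t : ℝ} :
    UnboundedOperator.eigenspace (I.momentum 1) t ≠ ⊥ ↔
      ∃ k, 1 ≤ k ∧ ∃ m : ℤ, t * I.len k = m := by
  constructor
  · intro h
    obtain ⟨f, hf, hf0⟩ := Submodule.exists_mem_ne_zero_of_ne_bot h
    by_contra hk
    exact hf0 (eq_zero_of_mem_eigenspace hf fun k h1 h2 => absurd ⟨k, h1, h2⟩ hk)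
  · rintro ⟨k, hk, hm⟩ h
    have := intervalWave_mem_eigenspace hk hm
    rw [h, Submodule.mem_bot] at this
    exact intervalWave_ne_zero hk t this

theorem pointSpectrum_momentum_one : UnboundedOperator.pointSpectrum (I.momentum 1) =
    {z : ℂ | ∃ k : ℕ, 1 ≤ k ∧ ∃ m : ℤ, z = ((1 / I.len k * m : ℝ) : ℂ)} := by
  ext z
  constructor
  · intro hz
    obtain ⟨f, hf, hf0⟩ := Submodule.exists_mem_ne_zero_of_ne_bot hz
    have him := UnboundedOperator.im_eq_zero_of_mem_eigenspace
      momentum_one_isEssentiallySurjective.symmetric hf hf0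
    have hzt : z = (z.re : ℂ) := by apply Complex.ext <;> simp [him]
    have hz' : UnboundedOperator.eigenspace (I.momentum 1) z ≠ ⊥ := hz
    rw [hzt] at hz'
    obtain ⟨k, hk, m, hm⟩ := eigenspace_ne_bot_iff.1 hz'
    refine ⟨k, hk, m, ?_⟩
    rw [hzt, ← hm]
    congr 1
    field_simp [(len_pos hk).ne']
  · rintro ⟨k, hk, m, rfl⟩
    refine eigenspace_ne_bot_iff.2 ⟨k, hk, m, ?_⟩
    field_simp [(len_pos hk).ne']

/-- Orthogonality of the interval waves bounds the rank from below. If `S` is finite, the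
coefficient map into `S → ℂ` is injective and bounds it from above; if `S` is infinite, the upper
bound in `ℕ∞` is trivial. -/
theorem multiplicity_momentum_one (t : ℝ) :
    UnboundedOperator.multiplicity (I.momentum 1) (t : ℂ) =
      Set.encard {k : ℕ | 1 ≤ k ∧ ∃ m : ℤ, t * I.len k = m} := by
  set S := {k : ℕ | 1 ≤ k ∧ ∃ m : ℤ, t * I.len k = m}
  set V := UnboundedOperator.eigenspace (I.momentum 1) (t : ℂ)
  let e : S → V := fun k => ⟨I.intervalWave k t, intervalWave_mem_eigenspace k.2.1 k.2.2⟩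
  have hli : LinearIndependent ℂ e := by
    refine linearIndependent_of_ne_zero_of_inner_eq_zero (fun k h => ?_) fun k l hkl => ?_
    · exact intervalWave_ne_zero k.2.1 t (congrArg Subtype.val h)
    · exact inner_intervalWave_of_ne k.2.1 l.2.1 (fun h => hkl (Subtype.ext h)) t
  have hle : Cardinal.mk S ≤ Module.rank ℂ V := hli.cardinal_le_rank
  rw [UnboundedOperator.multiplicity, ← Set.toENat_cardinalMk]
  refine le_antisymm ?_ (OrderHomClass.mono Cardinal.toENat hle)
  rcases S.finite_or_infinite with hS | hS
  · have := hS.fintype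
    let A : V →ₗ[ℂ] (S → ℂ) := LinearMap.pi fun k => (innerSL ℂ (I.intervalWave k t)).toLinearMap ∘ₗ
      V.subtype
    have hA : Function.Injective A := by
      rw [← LinearMap.ker_eq_bot, LinearMap.ker_eq_bot']
      intro f hf
      refine Subtype.ext (eq_zero_of_mem_eigenspace f.2 fun k h1 h2 => ?_)
      exact congrFun hf ⟨k, h1, h2⟩
    refine OrderHomClass.mono Cardinal.toENat ?_
    have h := LinearMap.rank_le_of_injective A hA
    rwa [rank_fun', ← Cardinal.mk_fintype] at h
  · rw [Set.toENat_cardinalMk, hS.encard_eq]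
    exact le_top

/-! ### Spectrum and continuous spectrum -/

theorem memLp_indicator_wave_div (t : ℝ) :
    MemLp ((Ioi 1).indicator fun x : ℝ => wave t x / x) 2 (volume.restrict I.Ω) := by
  refine ((memLp_indicator_iff_restrict measurableSet_Ioi).2 ?_).restrict _
  have hc : ContinuousOn (fun x : ℝ => wave t x / x) (Ioi 1) := by
    refine (continuous_wave t).continuousOn.div Complex.continuous_ofReal.continuousOn
      fun x hx => ?_
    exact Complex.ofReal_ne_zero.2 (zero_lt_one.trans hx).ne'
  rw [memLp_two_iff_integrable_sq_norm (hc.aestronglyMeasurable measurableSet_Ioi)]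
  refine (integrableOn_Ioi_rpow_of_lt (a := -2) (by norm_num) zero_lt_one).congr_fun
    (fun x hx => ?_) measurableSet_Ioi
  have hx0 : 0 < x := zero_lt_one.trans hx
  simp only
  rw [norm_div, norm_wave, Complex.norm_real, Real.norm_of_nonneg hx0.le, Real.rpow_neg hx0.le]
  simp

variable (I)

/-- A function for which `P f - t f = y` has no square-integrable solution. -/
noncomputable def resonance (t : ℝ) : I.L2 := (memLp_indicator_wave_div t).toLp _

variable {I}

theorem resonance_ae_eq (t : ℝ) :
    I.resonance t =ᵐ[volume.restrict I.Ω] (Ioi 1).indicator fun x : ℝ => wave t x / x :=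
  MemLp.coeFn_toLp _

/-- On `(1, ∞)` a solution would be `wave t x * (c + 2πi log x)`, whose modulus tends to infinity.
The statement for pairs in the graph serves both the operator and its part in the continuous
subspace. -/
theorem sub_smul_ne_resonance {t : ℝ} {f g : I.L2} (h : (f, g) ∈ (I.momentum 1).graph) :
    g - (t : ℂ) • f ≠ I.resonance t := by
  intro hy
  rw [sub_eq_iff_eq_add'] at hy
  subst hy
  obtain ⟨F, hF⟩ := exists_isRep_of_mem_graph h
  have hx0 : ∀ x ∈ Ioi (1 : ℝ), x ≠ 0 := fun x hx => (zero_lt_one.trans hx).ne'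
  obtain ⟨c, hc⟩ := hF.eq_wave_mul (t := t) ordConnected_Ioi Ioi_subset_Ω
    (y := fun x => wave t x / x) (Y := fun x => 2 * Real.pi * Complex.I * (Real.log x : ℂ))
    (by
      filter_upwards [ae_restrict_Ω_iff.1 (L2.coeFn_smul (f := f) (z := t)),
        ae_restrict_Ω_iff.1 (resonance_ae_eq (I := I) t),
        ae_restrict_Ω_iff.1 (Lp.coeFn_add ((t : ℂ) • f) (I.resonance t))] with x h1 h2 h3 hx
      have hxΩ := Ioi_subset_Ω (I := I) hx
      rw [h3 hxΩ, Pi.add_apply, h1 hxΩ, h2 hxΩ, indicator_of_mem hx])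
    (contDiffOn_const.mul (Complex.ofRealCLM.contDiff.comp_contDiffOn
      (contDiffOn_id.log hx0)))
    (fun x hx => by
      have h1 := (Real.hasDerivAt_log (hx0 x hx)).ofReal_comp.const_mul
        (2 * Real.pi * Complex.I : ℂ)
      refine h1.congr_deriv ?_
      rw [← mul_div_assoc, wave_neg_mul]
      push_cast
      rw [one_div])
  -- The threshold `1 + ‖c‖` for `log x` ensures `2π log x - ‖c‖ ≥ 1`.
  obtain ⟨M, hM⟩ := (Real.tendsto_log_atTop.eventually_ge_atTop (1 + ‖c‖)).exists_forall_of_atTop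
  refine not_forall_le_norm hF.ae_eq (S := Ioi (max M 1)) measurableSet_Ioi
    ((Ioi_subset_Ioi (le_max_right _ _)).trans Ioi_subset_Ω) Real.volume_Ioi one_pos fun x hx => ?_
  have hx1 : x ∈ Ioi (1 : ℝ) := (le_max_right M 1).trans_lt hx
  have hlog := hM x ((le_max_left M 1).trans hx.le)
  have hl0 : 0 ≤ Real.log x := by linarith [norm_nonneg c]
  rw [hc x hx1, norm_mul, norm_wave, one_mul]
  have h1 : ‖2 * Real.pi * Complex.I * (Real.log x : ℂ)‖ = 2 * Real.pi * Real.log x := by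
    simp [abs_of_pos Real.pi_pos, abs_of_nonneg hl0]
  have h2 := norm_sub_norm_le (2 * Real.pi * Complex.I * (Real.log x : ℂ)) (-c)
  rw [sub_neg_eq_add, norm_neg, h1, add_comm _ c] at h2
  nlinarith [Real.pi_gt_three]

/-- The supports are disjoint up to null sets: eigenvectors vanish on the half-lines, and
`resonance` lives on `(1, ∞)`. -/
theorem resonance_mem_continuousSubspace (t : ℝ) :
    I.resonance t ∈ UnboundedOperator.continuousSubspace (I.momentum 1) := by
  rw [UnboundedOperator.continuousSubspace, Submodule.mem_orthogonal]
  intro v hv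
  refine Submodule.iSup_induction (motive := fun v => ⟪v, I.resonance t⟫_ℂ = 0) _ hv ?_
    (inner_zero_left _) fun a b ha hb => by rw [inner_add_left, ha, hb, add_zero]
  intro w v hv
  by_cases h0 : v = 0
  · rw [h0, inner_zero_left]
  have him := UnboundedOperator.im_eq_zero_of_mem_eigenspace
    momentum_one_isEssentiallySurjective.symmetric hv h0
  have hw : w = (w.re : ℂ) := by apply Complex.ext <;> simp [him]
  rw [hw] at hv
  rw [L2.inner_def]
  refine integral_eq_zero_of_ae ?_
  rw [EventuallyEq, ae_restrict_Ω_iff]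
  filter_upwards [ae_eq_zero_of_mem_eigenspace hv, ae_restrict_Ω_iff.1 (resonance_ae_eq (I := I) t)]
    with x h1 h2 hx
  rw [h2 hx]
  by_cases hx1 : x ∈ Ioi (1 : ℝ)
  · rw [h1 (Or.inr hx1), inner_zero_left, Pi.zero_apply]
  · rw [indicator_of_notMem hx1, inner_zero_right, Pi.zero_apply]

theorem spectrum_momentum_one :
    UnboundedOperator.spectrum (I.momentum 1) = Set.range (fun t : ℝ => (t : ℂ)) := by
  refine Subset.antisymm momentum_one_isEssentiallySurjective.spectrum_subset ?_
  rintro _ ⟨t, rfl⟩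
  exact UnboundedOperator.mem_spectrum_of_forall_ne (I.resonance t) fun x =>
    sub_smul_ne_resonance ((I.momentum 1).mem_graph x)

theorem continuousSpectrum_momentum_one :
    UnboundedOperator.continuousSpectrum (I.momentum 1) = Set.range (fun t : ℝ => (t : ℂ)) := by
  refine Subset.antisymm momentum_one_isEssentiallySurjective.continuousSpectrum_subset ?_
  rintro _ ⟨t, rfl⟩
  refine UnboundedOperator.mem_spectrum_of_forall_ne
    ⟨I.resonance t, resonance_mem_continuousSubspace t⟩ fun x hx => ?_
  exact sub_smul_ne_resonance (UnboundedOperator.mem_graph_part.1 (LinearPMap.mem_graph _ x))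
    (congrArg Subtype.val hx)

end IntervalSystem

/-- For `B = diag(1, 1, …)`, the momentum operator `P_B` is a selfadjoint restriction of the
maximal momentum operator, its spectrum is the real line, its point spectrum is
`⋃_{k ≥ 1} (1 / ℓ_k) ℤ`, all of it embedded in the continuous spectrum, and the multiplicity of
an eigenvalue `z` is the number of `k ≥ 1` with `z ℓ_k ∈ ℤ`. -/
theorem mainTheorem12 (I : IntervalSystem) :
    IsSelfAdjoint (I.momentum 1) ∧
    I.momentum 1 ≤ I.maximalMomentum ∧
    UnboundedOperator.spectrum (I.momentum 1) = Set.range (fun t : ℝ => (t : ℂ)) ∧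
    UnboundedOperator.continuousSpectrum (I.momentum 1) = Set.range (fun t : ℝ => (t : ℂ)) ∧
    UnboundedOperator.pointSpectrum (I.momentum 1) =
      {z : ℂ | ∃ k : ℕ, 1 ≤ k ∧ ∃ m : ℤ, z = ((1 / I.len k * m : ℝ) : ℂ)} ∧
    UnboundedOperator.embeddedPointSpectrum (I.momentum 1) =
      {z : ℂ | ∃ k : ℕ, 1 ≤ k ∧ ∃ m : ℤ, z = ((1 / I.len k * m : ℝ) : ℂ)} ∧
    ∀ t : ℝ, (t : ℂ) ∈ UnboundedOperator.pointSpectrum (I.momentum 1) →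
      UnboundedOperator.multiplicity (I.momentum 1) (t : ℂ) =
        Set.encard {k : ℕ | 1 ≤ k ∧ ∃ m : ℤ, t * I.len k = m} := by
  refine ⟨IntervalSystem.momentum_one_isEssentiallySurjective.isSelfAdjoint,
    IntervalSystem.momentum_le 1, IntervalSystem.spectrum_momentum_one,
    IntervalSystem.continuousSpectrum_momentum_one, IntervalSystem.pointSpectrum_momentum_one, ?_,
    fun t _ => IntervalSystem.multiplicity_momentum_one t⟩
  rw [UnboundedOperator.embeddedPointSpectrum, IntervalSystem.continuousSpectrum_momentum_one,
    IntervalSystem.pointSpectrum_momentum_one, Set.inter_eq_left]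
  rintro _ ⟨k, -, m, rfl⟩
  exact ⟨_, rfl⟩
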